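/- Let $d\ge 0$ be an integer and let $$P=\mathcal{HS}_{d+1}:=\{x\in\mathbb{Z}^{d+1} : x_1+\cdots+x_{d+1}\ge 0\},\qquad u\le v \iff u_i\le v_i\ \text{for all } i,$$ a graded poset with layers $L_t=\{x\in\mathbb{Z}^{d+1} : x_1+\cdots+x_{d+1}=t\}$, $t\ge 0$, in which every non-minimal element covers exactly $d+1$ elements. Let $\alpha>0$, $\varepsilon>0$, $\mu_0\in\mathbb{R}$ and $\sigma_0^2>0$. Let $X_0\sim\mathcal{N}(\mu_0,\sigma_0^2)$ and, for each covering pair $u\lessdot v$ of $P$, let $W_{u,v}\sim\mathcal{N}(0,1)$, all these random variables being jointly independent. Put $X_v=X_0$ for $v\in L_0$ and $$X_v=\alpha\sum_{u\,:\,u\lessdot v}\bigl(X_u+\varepsilon W_{u,v}\bigr)\qquad\text{for } v\in L_t,\ t\ge 1.$$ A window of width $N$ is a set $\bigl([x_1,x_1+N)\times\cdots\times[x_{d+1},x_{d+1}+N)\bigr)\cap P$ with $x_1,\dots,x_{d+1}\in\mathbb{Z}$. We say that local reconstruction is possible if there are a finite number $N$, a sequence $(\mathcal{W}_t)_{t\ge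 0}$ of windows of width $N$, and a function $c:P\to\mathbb{R}$ such that for every $t$ the restriction $c|_{L_t}$ is supported on $\mathcal{W}_t$, and the random variables $\zeta_t:=\sum_{u\in L_t}c_uX_u$ satisfy $\operatorname{Var}(\zeta_t)>0$ for all $t\ge 0$ and $$\operatorname{corr}(\zeta_t,X_0)=\frac{\operatorname{Cov}(\zeta_t,X_0)}{\sqrt{\operatorname{Var}(\zeta_t)\operatorname{Var}(X_0)}}$$ does not converge to $0$ as $t\to\infty$. If this holds with $N=1$, we say that single-vertex reconstruction is possible. Then: (a) If $\alpha>\frac1{d+1}$, single-vertex reconstruction is possible. (b) If $\alpha<\frac1{d+1}$, local reconstruction is not possible. (c) If $\alpha=\frac1{d+1}$, single-vertex reconstruction is possible when $d\ge 3$, and local reconstruction is not possible when $d\in\{0,1,2\}$. -/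

import Mathlib

open MeasureTheory ProbabilityTheory Filter Topology
open scoped NNReal

/-! ## The Gaussian propagation model on a graded poset -/

/-- The covering pairs `u ⋖ v` of a poset; these index the noise variables. -/
abbrev CoverPair (P : Type*) [PartialOrder P] : Type _ := {e : P × P // e.1 ⋖ e.2}

/-- The random inputs of the model: `X₀ ∼ N(m, s)` and standard Gaussian noises `W u⋖v ∼ N(0, 1)`,
all of them (`X₀` included) jointly independent. -/
structure IsGaussianInput {P Ω : Type*} [PartialOrder P] [MeasurableSpace Ω] (μ : Measure Ω)
    (m : ℝ) (s : ℝ≥0) (X₀ : Ω → ℝ) (W : CoverPair P → Ω → ℝ) : Prop where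
  law_root : HasLaw X₀ (gaussianReal m s) μ
  law_noise : ∀ e, HasLaw (W e) (gaussianReal 0 1) μ
  indep : iIndepFun (fun o : Option (CoverPair P) => o.elim X₀ W) μ

open Classical in
/-- The random variables `X_v` attached to the elements `v` of a graded poset `P`.
If `v` is minimal then `X_v = X₀`; otherwise, with `𝔭(v) = {u | u ⋖ v}`,
`X_v = α_{|𝔭(v)|} * ∑_{u ∈ 𝔭(v)} (X_u + ε * W_{u,v})`. -/
noncomputable def modelField {P Ω : Type*} [PartialOrder P] [GradeMinOrder ℕ P]
    (α : ℕ → ℝ) (ε : ℝ) (X₀ : Ω → ℝ) (W : CoverPair P → Ω → ℝ) (v : P) : Ω → ℝ := fun ω =>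
  if IsMin v then X₀ ω
  else α ({u : P | u ⋖ v}.ncard) *
    ∑ᶠ u : {u : P // u ⋖ v},
      (modelField α ε X₀ W u.1 ω + ε * W ⟨(u.1, v), u.2⟩ ω)
termination_by grade ℕ v
decreasing_by exact grade_strictMono u.2.lt

theorem modelField_of_isMin {P Ω : Type*} [PartialOrder P] [GradeMinOrder ℕ P]
    (α : ℕ → ℝ) (ε : ℝ) (X₀ : Ω → ℝ) (W : CoverPair P → Ω → ℝ) {v : P} (hv : IsMin v) :
    modelField α ε X₀ W v = X₀ := by
  funext ω
  rw [modelField, if_pos hv]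

theorem modelField_of_not_isMin {P Ω : Type*} [PartialOrder P] [GradeMinOrder ℕ P]
    (α : ℕ → ℝ) (ε : ℝ) (X₀ : Ω → ℝ) (W : CoverPair P → Ω → ℝ) {v : P} (hv : ¬ IsMin v) (ω : Ω) :
    modelField α ε X₀ W v ω = α ({u : P | u ⋖ v}.ncard) *
      ∑ᶠ u : {u : P // u ⋖ v},
        (modelField α ε X₀ W u.1 ω + ε * W ⟨(u.1, v), u.2⟩ ω) := by
  rw [modelField, if_neg hv]

/-- The layer `L_t`: the elements of rank `t`. -/
def layer (P : Type*) [PartialOrder P] [GradeMinOrder ℕ P] (t : ℕ) : Set P :=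
  {u | grade ℕ u = t}

/-- The linear estimator `ζ_t = ∑_{u ∈ L_t} c_u X_u`
(used only when `c` has finite support on each layer). -/
noncomputable def estimator {P Ω : Type*} [PartialOrder P] [GradeMinOrder ℕ P]
    (X : P → Ω → ℝ) (c : P → ℝ) (t : ℕ) : Ω → ℝ := fun ω =>
  ∑ᶠ u ∈ layer P t, c u * X u ω

/-- `corr(Y, Z) = Cov(Y, Z) / √(Var Y * Var Z)`. -/
noncomputable def correlation {Ω : Type*} [MeasurableSpace Ω] (μ : Measure Ω) (Y Z : Ω → ℝ) : ℝ :=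
  cov[Y, Z; μ] / √(Var[Y; μ] * Var[Z; μ])

/-! ## The half-space poset -/

/-- The half-space `{x ∈ ℤⁿ | x₁ + ⋯ + xₙ ≥ 0}` with the entrywise order. -/
abbrev HalfSpace (n : ℕ) : Type := {x : Fin n → ℤ // 0 ≤ ∑ i, x i}

theorem HalfSpace.sum_covBy {n : ℕ} {u v : HalfSpace n} (h : u ⋖ v) :
    ∑ i, v.1 i = ∑ i, u.1 i + 1 := by
  have hle : ∀ i, u.1 i ≤ v.1 i := h.lt.le
  obtain ⟨i, hi⟩ : ∃ i, u.1 i < v.1 i := by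
    by_contra! hc
    exact h.lt.not_ge (show v ≤ u from hc)
  have hsum : ∑ j, (u.1 + Pi.single i 1 : Fin n → ℤ) j = ∑ j, u.1 j + 1 := by
    simp [Finset.sum_add_distrib]
  let w : HalfSpace n := ⟨u.1 + Pi.single i 1, by rw [hsum]; linarith [u.2]⟩
  have huw : u < w := by
    refine lt_of_le_not_ge (fun j => ?_) fun hc => ?_
    · by_cases hj : j = i
      · subst hj; simp [w]
      · simp [w, hj]
    · have := hc i
      simp [w] at this
  have hwv : w ≤ v := by
    intro j
    by_cases hj : j = i
    · subst hj; simpa [w] using hi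
    · simpa [w, hj] using hle j
  have hwv' : w = v := by
    by_contra hne
    exact h.2 huw (lt_of_le_of_ne hwv hne)
  rw [← hwv', ← hsum]

theorem HalfSpace.sum_lt {n : ℕ} {u v : HalfSpace n} (h : u < v) :
    ∑ i, u.1 i < ∑ i, v.1 i := by
  have hle : ∀ i, u.1 i ≤ v.1 i := h.le
  obtain ⟨i, hi⟩ : ∃ i, u.1 i < v.1 i := by
    by_contra! hc
    exact h.not_ge (show v ≤ u from hc)
  exact Finset.sum_lt_sum (fun j _ => hle j) ⟨i, Finset.mem_univ i, hi⟩

/-- The half-space (of positive dimension) is graded, the rank of `x` being `x₁ + ⋯ + xₙ`. -/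
instance HalfSpace.gradeMinOrder (d : ℕ) : GradeMinOrder ℕ (HalfSpace (d + 1)) where
  grade u := (∑ i, u.1 i).toNat
  grade_strictMono u v h := by
    have h1 := HalfSpace.sum_lt h
    have h2 := u.2
    show (∑ i, u.1 i).toNat < (∑ i, v.1 i).toNat
    omega
  covBy_grade u v h := by
    have h1 := HalfSpace.sum_covBy h
    have h2 := u.2
    rw [Nat.covBy_iff_add_one_eq]
    omega
  isMin_grade u h := by
    have hu := u.2
    rw [isMin_iff_eq_bot, Nat.bot_eq_zero]
    by_contra hne
    have hsum : ∑ j, (u.1 - Pi.single 0 1 : Fin (d + 1) → ℤ) j = ∑ j, u.1 j - 1 := by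
      simp [Finset.sum_sub_distrib]
    let w : HalfSpace (d + 1) := ⟨u.1 - Pi.single 0 1, by rw [hsum]; omega⟩
    have hwu : w ≤ u := by
      intro j
      by_cases hj : j = 0
      · subst hj; simp [w]
      · simp [w, hj]
    have := h hwu 0
    simp [w] at this

/-- The window of width `N` with corner `x` in the half-space:
`([x₁, x₁ + N) × ⋯ × [xₙ, xₙ + N)) ∩ HS`. -/
def window {n : ℕ} (x : Fin n → ℤ) (N : ℕ) : Set (HalfSpace n) :=
  {u | ∀ i, u.1 i ∈ Set.Ico (x i) (x i + N)}

/-! ## Local reconstruction -/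

/-- Reconstruction of `X₀` from windows of width `N`: there are windows `𝒲_t` of width `N` and
coefficients `c`, supported in layer `t` on `𝒲_t`, such that `ζ_t = ∑_{u ∈ L_t} c_u X_u` has
positive variance for all `t` and `corr(ζ_t, X₀)` does not converge to `0`. -/
def WindowReconstruction {d : ℕ} {Ω : Type*} [MeasurableSpace Ω] (μ : Measure Ω)
    (X₀ : Ω → ℝ) (X : HalfSpace (d + 1) → Ω → ℝ) (N : ℕ) : Prop :=
  ∃ (x : ℕ → Fin (d + 1) → ℤ) (c : HalfSpace (d + 1) → ℝ),
    (∀ t, ∀ u ∈ layer (HalfSpace (d + 1)) t, c u ≠ 0 → u ∈ window (x t) N) ∧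
    (∀ t, 0 < Var[estimator X c t; μ]) ∧
    ¬ Tendsto (fun t => correlation μ (estimator X c t) X₀) atTop (𝓝 0)

/-- Local reconstruction is possible. -/
def LocalReconstruction {d : ℕ} {Ω : Type*} [MeasurableSpace Ω] (μ : Measure Ω)
    (X₀ : Ω → ℝ) (X : HalfSpace (d + 1) → Ω → ℝ) : Prop :=
  ∃ N : ℕ, WindowReconstruction μ X₀ X N

/-- Single-vertex reconstruction is possible. -/
def SingleVertexReconstruction {d : ℕ} {Ω : Type*} [MeasurableSpace Ω] (μ : Measure Ω)
    (X₀ : Ω → ℝ) (X : HalfSpace (d + 1) → Ω → ℝ) : Prop :=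
  WindowReconstruction μ X₀ X 1

/-! ## The averaging operator on finitely supported functions on the lattice -/

/-! Put `ρ = α (d + 1) * (d + 1)` and let `descend` be one step of the downward simple random walk
on coefficients. Unrolling the recursion for a combination of layer `t` with coefficients `c` gives
`ρ ^ t * mass c` times `X₀`, plus the noise entering at levels `t - k`, weighted by `ρ ^ k` and
`descend^[k] c` (`linearCombination_latticeField`). Different levels carry uncorrelated noise, so up
to a constant factor the noise variance is `∑ k < t, ρ ^ (2 * k) * sqNorm (descend^[k] c)`
(`variance_latticeField`). Reconstruction is decided by comparing this sum with the signal `(ρ ^ t *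
mass c) ^ 2`.

If `ρ > 1`, a single vertex has `sqNorm` at most 1 at every step, and the geometric sum is `O(ρ ^ (2
* t))`. If `ρ < 1`, the term `k = 0` suffices: on a window Cauchy–Schwarz bounds `mass c ^ 2` by a
constant times `sqNorm c`, while `ρ ^ (2 * t)` tends to 0.

If `ρ = 1`, the sum counts expected collisions of two independent walks, which meet at time `k` with
probability of order `k ^ (-d / 2)`. For `d ≥ 3` Stirling's formula bounds every multinomial weight
by `O(k ^ (-3 / 2))`, which is summable (`exists_sum_sqNorm_single_le`). For `d ≤ 2` Chebyshev's
inequality keeps half of the mass on `O(k)` points, so Cauchy–Schwarz bounds the `k`-th term below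
by a multiple of `mass c ^ 2 / k`, and the harmonic series diverges
(`exists_mul_sq_mass_le_sum_sqNorm`). -/

section Lattice

variable {n : ℕ}

/-- One step of the downward simple random walk: `(descend c) y = (∑ i, c (y + eᵢ)) / n`. -/
noncomputable def descend (c : (Fin n → ℤ) →₀ ℝ) : (Fin n → ℤ) →₀ ℝ :=
  (1 / n : ℝ) • ∑ i, Finsupp.equivMapDomain (Equiv.subRight (Pi.single i 1)) c

theorem descend_apply (c : (Fin n → ℤ) →₀ ℝ) (y : Fin n → ℤ) :
    descend c y = (1 / n : ℝ) * ∑ i, c (y + Pi.single i 1) := by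
  simp [descend, Finsupp.equivMapDomain_apply]

/-- Duality: averaging a field over lower neighbours is the same as pushing its coefficients down.
It turns the recursion for the field into one for coefficients. -/
theorem linearCombination_descend {M : Type*} [AddCommGroup M] [Module ℝ M]
    (f : (Fin n → ℤ) → M) (c : (Fin n → ℤ) →₀ ℝ) :
    Finsupp.linearCombination ℝ f (descend c) =
      Finsupp.linearCombination ℝ (fun x => (1 / n : ℝ) • ∑ i, f (x - Pi.single i 1)) c := by
  simp only [descend, map_smul, map_sum, Finsupp.linearCombination_equivMapDomain]
  simp only [Finsupp.linearCombination_apply, Finsupp.sum, Finset.smul_sum]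
  rw [Finset.sum_comm]
  refine Finset.sum_congr rfl fun x _ => Finset.sum_congr rfl fun i _ => ?_
  rw [smul_comm]; rfl

/-- The total mass of a finitely supported function. -/
noncomputable def mass (c : (Fin n → ℤ) →₀ ℝ) : ℝ :=
  Finsupp.linearCombination ℝ (fun _ => (1 : ℝ)) c

theorem mass_eq_sum (c : (Fin n → ℤ) →₀ ℝ) : mass c = ∑ x ∈ c.support, c x := by
  simp [mass, Finsupp.linearCombination_apply, Finsupp.sum]

/-- The squared `ℓ²` norm of a finitely supported function. -/
noncomputable def sqNorm (c : (Fin n → ℤ) →₀ ℝ) : ℝ := ∑ x ∈ c.support, c x ^ 2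

theorem sqNorm_nonneg (c : (Fin n → ℤ) →₀ ℝ) : 0 ≤ sqNorm c :=
  Finset.sum_nonneg fun _ _ => sq_nonneg _

/-- `c` is supported on the points of coordinate sum `t`. -/
def OnLevel (c : (Fin n → ℤ) →₀ ℝ) (t : ℤ) : Prop := ∀ x, c x ≠ 0 → ∑ i, x i = t

theorem sum_add_single (x : Fin n → ℤ) (i : Fin n) :
    ∑ j, (x + Pi.single i 1 : Fin n → ℤ) j = ∑ j, x j + 1 := by
  simp [Finset.sum_add_distrib]

theorem sum_sub_single (x : Fin n → ℤ) (i : Fin n) :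
    ∑ j, (x - Pi.single i 1 : Fin n → ℤ) j = ∑ j, x j - 1 := by
  simp [Finset.sum_sub_distrib]

theorem exists_ne_zero_of_descend_ne_zero {c : (Fin n → ℤ) →₀ ℝ} {y : Fin n → ℤ}
    (h : descend c y ≠ 0) : ∃ i, c (y + Pi.single i 1) ≠ 0 := by
  by_contra! hc
  simp [descend_apply, hc] at h

theorem OnLevel.descend {c : (Fin n → ℤ) →₀ ℝ} {t : ℤ} (h : OnLevel c t) :
    OnLevel (descend c) (t - 1) := by
  intro y hy
  obtain ⟨i, hi⟩ := exists_ne_zero_of_descend_ne_zero hy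
  have := h _ hi
  rw [sum_add_single] at this
  omega

theorem OnLevel.iterate_descend {c : (Fin n → ℤ) →₀ ℝ} {t : ℤ} (h : OnLevel c t) (k : ℕ) :
    OnLevel (_root_.descend^[k] c) (t - k) := by
  induction k with
  | zero => simpa using h
  | succ k ih =>
    rw [Function.iterate_succ_apply']
    have := ih.descend
    push_cast
    rwa [← sub_sub]

theorem iterate_descend_nonneg {c : (Fin n → ℤ) →₀ ℝ} (hc : ∀ y, 0 ≤ c y) (k : ℕ) (y : Fin n → ℤ) :
    0 ≤ descend^[k] c y := by
  induction k generalizing y with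
  | zero => exact hc y
  | succ k ih =>
    rw [Function.iterate_succ_apply', descend_apply]
    exact mul_nonneg (by positivity) (Finset.sum_nonneg fun i _ => ih _)

theorem sqNorm_le_mul_mass {c : (Fin n → ℤ) →₀ ℝ} {M : ℝ} (h0 : ∀ y, 0 ≤ c y)
    (hc : ∀ y, c y ≤ M) : sqNorm c ≤ M * mass c := by
  rw [sqNorm, mass_eq_sum, Finset.mul_sum]
  refine Finset.sum_le_sum fun x _ => ?_
  rw [sq]
  exact mul_le_mul_of_nonneg_right (hc x) (h0 x)

theorem mass_single (v : Fin n → ℤ) : mass (Finsupp.single v 1) = 1 := by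
  simp [mass]

theorem single_one_nonneg (v y : Fin n → ℤ) : (0 : ℝ) ≤ Finsupp.single v (1 : ℝ) y := by
  rw [Finsupp.single_apply]; split_ifs <;> norm_num

theorem single_one_le (v y : Fin n → ℤ) : Finsupp.single v (1 : ℝ) y ≤ 1 := by
  rw [Finsupp.single_apply]; split_ifs <;> norm_num

/-- The balanced multinomial coefficient is the largest: `x! / m ^ x` is minimal at `x = m`, and in
the product over `i` the powers of `m` cancel because the exponents sum to `n * m`. -/
theorem factorial_pow_le_prod_factorial (m : ℕ) (z : Fin n → ℕ) (hz : ∑ i, z i = n * m) :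
    m.factorial ^ n ≤ ∏ i, (z i).factorial := by
  rcases Nat.eq_zero_or_pos m with rfl | hm
  · simpa using Nat.succ_le_of_lt (Finset.prod_pos fun i _ => Nat.factorial_pos (z i))
  have key : ∀ x : ℕ, m.factorial * m ^ x ≤ x.factorial * m ^ m := by
    intro x
    rcases le_total m x with h | h
    · calc m.factorial * m ^ x = m.factorial * m ^ (x - m) * m ^ m := by
            rw [mul_assoc, ← pow_add, Nat.sub_add_cancel h]
        _ ≤ _ := Nat.mul_le_mul_right _ (Nat.factorial_mul_pow_sub_le_factorial h)
    · calc m.factorial * m ^ x ≤ x.factorial * m ^ (m - x) * m ^ x := by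
            refine Nat.mul_le_mul_right _ ?_
            have := Nat.factorial_mul_descFactorial (Nat.sub_le m x)
            rw [Nat.sub_sub_self h] at this
            rw [← this]
            exact Nat.mul_le_mul_left _ (Nat.descFactorial_le_pow _ _)
        _ = _ := by rw [mul_assoc, ← pow_add, Nat.sub_add_cancel h]
  have h := Finset.prod_le_prod' (s := Finset.univ) fun i _ => key (z i)
  rw [Finset.prod_mul_distrib, Finset.prod_mul_distrib, Finset.prod_pow_eq_pow_sum, hz,
    Finset.prod_const, Finset.prod_const, ← pow_mul, Finset.card_univ, Fintype.card_fin,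
    mul_comm m] at h
  exact Nat.le_of_mul_le_mul_right h (by positivity)

variable [NeZero n]

theorem mass_descend (c : (Fin n → ℤ) →₀ ℝ) : mass (descend c) = mass c := by
  have : (n : ℝ) ≠ 0 := Nat.cast_ne_zero.2 (NeZero.ne n)
  simp [mass, linearCombination_descend, this]

theorem mass_iterate_descend (c : (Fin n → ℤ) →₀ ℝ) (k : ℕ) : mass (descend^[k] c) = mass c := by
  induction k with
  | zero => rfl
  | succ k ih => rw [Function.iterate_succ_apply', mass_descend, ih]

theorem descend_le {c : (Fin n → ℤ) →₀ ℝ} {M : ℝ} (hc : ∀ y, c y ≤ M) (y : Fin n → ℤ) :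
    descend c y ≤ M := by
  have hn : (n : ℝ) ≠ 0 := Nat.cast_ne_zero.2 (NeZero.ne n)
  rw [descend_apply]
  calc (1 / n : ℝ) * ∑ i, c (y + Pi.single i 1) ≤ (1 / n : ℝ) * ∑ _i : Fin n, M := by
        gcongr with i; exact hc _
    _ = M := by simp [hn]

theorem iterate_descend_le {c : (Fin n → ℤ) →₀ ℝ} {M : ℝ} (hc : ∀ y, c y ≤ M) (k : ℕ)
    (y : Fin n → ℤ) : descend^[k] c y ≤ M := by
  induction k generalizing y with
  | zero => exact hc y
  | succ k ih => rw [Function.iterate_succ_apply']; exact descend_le ih y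

theorem sqNorm_iterate_descend_single_le (v : Fin n → ℤ) {k : ℕ} {M : ℝ}
    (h : ∀ y, descend^[k] (Finsupp.single v 1) y ≤ M) :
    sqNorm (descend^[k] (Finsupp.single v 1)) ≤ M := by
  have := sqNorm_le_mul_mass (iterate_descend_nonneg (single_one_nonneg v) k) h
  rwa [mass_iterate_descend, mass_single, mul_one] at this

theorem sqNorm_iterate_descend_single_le_one (v : Fin n → ℤ) (k : ℕ) :
    sqNorm (descend^[k] (Finsupp.single v 1)) ≤ 1 :=
  sqNorm_iterate_descend_single_le v (iterate_descend_le (single_one_le v) k)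

/-! ## Decay of the random walk in dimension at least three -/

/-- Upper bound for the multinomial weights of the walk. -/
theorem iterate_descend_single_apply_mul_le (v : Fin n → ℤ) (k : ℕ) (y : Fin n → ℤ) :
    (∀ z : Fin n → ℕ, v = y + (fun i => (z i : ℤ)) →
      descend^[k] (Finsupp.single v 1) y * ((∏ i, (z i).factorial : ℕ) * (n : ℝ) ^ k)
        ≤ k.factorial) ∧
    (descend^[k] (Finsupp.single v 1) y ≠ 0 →
      ∃ z : Fin n → ℕ, v = y + (fun i => (z i : ℤ)) ∧ ∑ i, z i = k) := by
  have hn : (n : ℝ) ≠ 0 := Nat.cast_ne_zero.2 (NeZero.ne n)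
  induction k generalizing y with
  | zero =>
    simp only [Function.iterate_zero, id, Finsupp.single_apply]
    refine ⟨fun z hz => ?_, fun h => ?_⟩
    · split_ifs with hvy
      · have : ∀ i, z i = 0 := fun i => by
          have := congrFun hz i
          rw [hvy] at this
          simpa using this
        simp [this]
      · simp
    · have hvy : v = y := by by_contra hne; simp [hne] at h
      exact ⟨0, by simp [hvy, funext_iff], by simp⟩
  | succ k ih =>
    rw [Function.iterate_succ_apply']
    refine ⟨fun z hz => ?_, fun h => ?_⟩
    -- Pascal's rule for multinomial weights. The support half of the induction hypothesis forces `z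
    -- = w + eᵢ` wherever the weight is nonzero, hence the factor `z i`.
    · have key : ∀ i, descend^[k] (Finsupp.single v 1) (y + Pi.single i 1) *
          ((∏ i, (z i).factorial : ℕ) * (n : ℝ) ^ k) ≤ z i * k.factorial := by
        intro i
        by_cases h0 : descend^[k] (Finsupp.single v 1) (y + Pi.single i 1) = 0
        · rw [h0, zero_mul]; positivity
        obtain ⟨w, hw, -⟩ := (ih (y + Pi.single i 1)).2 h0
        have hzw : z = Function.update w i (w i + 1) := by
          funext j
          have h1 := congrFun hz j
          have h2 := congrFun hw j
          by_cases hj : j = i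
          · subst hj
            simp at h1 h2 ⊢
            omega
          · simp [hj] at h1 h2 ⊢
            omega
        have hprod : ∏ j, (z j).factorial = z i * ∏ j, (w j).factorial := by
          rw [← Finset.mul_prod_erase _ _ (Finset.mem_univ i),
            ← Finset.mul_prod_erase Finset.univ (fun j => (w j).factorial) (Finset.mem_univ i),
            ← mul_assoc, hzw, Function.update_self, Nat.factorial_succ]
          congr 1
          refine Finset.prod_congr rfl fun j hj => ?_
          rw [Function.update_of_ne (Finset.ne_of_mem_erase hj)]
        have := (ih (y + Pi.single i 1)).1 w hw
        rw [hprod]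
        push_cast at this ⊢
        calc _ = (z i : ℝ) * (descend^[k] (Finsupp.single v 1) (y + Pi.single i 1) *
              ((∏ j, ((w j).factorial : ℝ)) * (n : ℝ) ^ k)) := by ring
          _ ≤ _ := by gcongr
      -- The identity `∑ z i = k + 1` is available only when `y` is reachable from `v`; otherwise
      -- the weight vanishes and the bound is trivial.
      have hsum : (∑ i, (z i : ℝ)) * k.factorial ≤ (k + 1).factorial ∨
          descend (descend^[k] (Finsupp.single v 1)) y = 0 := by
        by_cases h0 : descend (descend^[k] (Finsupp.single v 1)) y = 0
        · exact Or.inr h0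
        · left
          obtain ⟨i, hi⟩ := exists_ne_zero_of_descend_ne_zero h0
          obtain ⟨w, hw, hwk⟩ := (ih (y + Pi.single i 1)).2 hi
          have : ∑ i, z i = k + 1 := by
            have h1 : ∑ j, v j = ∑ j, y j + ∑ j, (z j : ℤ) := by
              rw [← Finset.sum_add_distrib]; exact Finset.sum_congr rfl fun j _ => congrFun hz j
            have h2 : ∑ j, v j = ∑ j, (y + Pi.single i 1 : Fin n → ℤ) j + ∑ j, (w j : ℤ) := by
              rw [← Finset.sum_add_distrib]; exact Finset.sum_congr rfl fun j _ => congrFun hw j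
            rw [sum_add_single] at h2
            zify at hwk ⊢
            omega
          rw [← Nat.cast_sum, this, Nat.factorial_succ, Nat.cast_mul]
      rcases hsum with hsum | hsum
      · rw [descend_apply]
        calc _ = ∑ i, descend^[k] (Finsupp.single v 1) (y + Pi.single i 1) *
              ((∏ i, (z i).factorial : ℕ) * (n : ℝ) ^ k) := by
              rw [← Finset.sum_mul, pow_succ]; field_simp
          _ ≤ ∑ i, (z i : ℝ) * k.factorial := Finset.sum_le_sum fun i _ => key i
          _ ≤ _ := by rwa [← Finset.sum_mul]
      · rw [hsum, zero_mul]; positivity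
    · obtain ⟨i, hi⟩ := exists_ne_zero_of_descend_ne_zero h
      obtain ⟨w, hw, hwk⟩ := (ih (y + Pi.single i 1)).2 hi
      refine ⟨w + Pi.single i 1, ?_, ?_⟩
      · rw [hw, add_assoc]
        congr 1
        funext j
        by_cases hj : j = i
        · subst hj; simp [add_comm]
        · simp [hj]
      · simp [Finset.sum_add_distrib, hwk]

end Lattice

/-- The Stirling sequence decreases from its value `e / √2` at 1. -/
theorem factorial_le_exp_mul_sqrt_mul (N : ℕ) (hN : N ≠ 0) :
    (N.factorial : ℝ) ≤ Real.exp 1 * √N * (N / Real.exp 1) ^ N := by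
  obtain ⟨M, rfl⟩ := Nat.exists_eq_succ_of_ne_zero hN
  have h := Stirling.stirlingSeq'_antitone (Nat.zero_le M)
  simp only [Function.comp, Nat.succ_eq_add_one, zero_add, Stirling.stirlingSeq_one] at h
  rw [Stirling.stirlingSeq, div_le_iff₀ (by positivity)] at h
  refine h.trans (le_of_eq ?_)
  rw [Real.sqrt_mul (by norm_num)]
  field_simp

theorem sqrt_mul_pow_le_factorial (m : ℕ) :
    √m * (m / Real.exp 1) ^ m ≤ (m.factorial : ℝ) := by
  refine le_trans ?_ (Stirling.le_factorial_stirling m)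
  gcongr
  nlinarith [Real.pi_gt_three, (Nat.cast_nonneg m : (0 : ℝ) ≤ m)]

/-- Stirling estimate for the central multinomial coefficient with at least four parts. -/
theorem factorial_mul_le_of_four_le {n m : ℕ} (hn : 4 ≤ n) (hm : m ≠ 0) :
    ((n * m).factorial : ℝ) ≤
      Real.exp 1 * √n / √m ^ 3 * ((m.factorial : ℝ) ^ n * (n : ℝ) ^ (n * m)) := by
  have hm1 : (1 : ℝ) ≤ m := by exact_mod_cast Nat.one_le_iff_ne_zero.2 hm
  have hs : (1 : ℝ) ≤ √m := Real.one_le_sqrt.2 hm1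
  -- Only four of the `n` factors `√m` are kept. One cancels against `√(n * m)` from the upper
  -- bound, leaving the decay `√m ^ 3`.
  have hlow : √m ^ 4 * (m / Real.exp 1) ^ (n * m) ≤ (m.factorial : ℝ) ^ n := by
    calc √m ^ 4 * (m / Real.exp 1) ^ (n * m) ≤ √m ^ n * (m / Real.exp 1) ^ (n * m) := by gcongr
      _ = (√m * (m / Real.exp 1) ^ m) ^ n := by rw [mul_pow, ← pow_mul, mul_comm m n]
      _ ≤ _ := by gcongr; exact sqrt_mul_pow_le_factorial m
  calc ((n * m).factorial : ℝ)
      ≤ Real.exp 1 * √(n * m : ℕ) * ((n * m : ℕ) / Real.exp 1) ^ (n * m) :=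
        factorial_le_exp_mul_sqrt_mul _ (by positivity)
    _ = Real.exp 1 * √n / √m ^ 3 *
          ((√m ^ 4 * (m / Real.exp 1) ^ (n * m)) * (n : ℝ) ^ (n * m)) := by
        push_cast
        rw [Real.sqrt_mul (by positivity), mul_div_assoc, mul_pow]
        field_simp
    _ ≤ _ := by gcongr

section Decay

variable {n : ℕ} [NeZero n]

theorem iterate_descend_mul_single_le (hn : 4 ≤ n) {m : ℕ} (hm : m ≠ 0) (v y : Fin n → ℤ) :
    descend^[n * m] (Finsupp.single v 1) y ≤ Real.exp 1 * √n / √m ^ 3 := by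
  obtain ⟨h1, h2⟩ := iterate_descend_single_apply_mul_le v (n * m) y
  by_cases h0 : descend^[n * m] (Finsupp.single v 1) y = 0
  · rw [h0]; positivity
  obtain ⟨z, hz, hzs⟩ := h2 h0
  have hpos : (0 : ℝ) < (∏ i, (z i).factorial : ℕ) * (n : ℝ) ^ (n * m) := by positivity
  refine le_of_mul_le_mul_right (((h1 z hz).trans (factorial_mul_le_of_four_le hn hm)).trans ?_) hpos
  gcongr
  exact_mod_cast factorial_pow_le_prod_factorial m z hzs

/-- Since `descend` does not raise an upper bound, the estimate at the multiple `n * (k / n)`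
carries over to `k`, with `k + 1 ≤ 2 * n * (k / n)`. For `k < n` the trivial bound 1 is enough. -/
theorem iterate_descend_single_le (hn : 4 ≤ n) (k : ℕ) (v y : Fin n → ℤ) :
    descend^[k] (Finsupp.single v 1) y ≤ Real.exp 1 * √n * √(2 * n) ^ 3 / √(k + 1 : ℕ) ^ 3 := by
  have hn1 : (1 : ℝ) ≤ n := by exact_mod_cast (by omega : 1 ≤ n)
  have he : (1 : ℝ) ≤ Real.exp 1 * √n :=
    one_le_mul_of_one_le_of_one_le (Real.one_le_exp zero_le_one) (Real.one_le_sqrt.2 hn1)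
  have hk : (0 : ℝ) < √(k + 1 : ℕ) ^ 3 := by positivity
  rcases Nat.eq_zero_or_pos (k / n) with h | h
  · have hkn : k + 1 ≤ n := (Nat.div_eq_zero_iff_lt (by omega)).1 h
    refine (iterate_descend_le (single_one_le v) k y).trans ?_
    rw [le_div_iff₀ hk]
    refine mul_le_mul he ?_ hk.le (by positivity)
    gcongr
    have : ((k + 1 : ℕ) : ℝ) ≤ n := by exact_mod_cast hkn
    linarith
  · set m := k / n with hm
    have hdiv : k % n + n * m = k := Nat.mod_add_div k n
    have hle := iterate_descend_le (iterate_descend_mul_single_le hn h.ne' v) (k % n) y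
    rw [← Function.iterate_add_apply, hdiv] at hle
    refine hle.trans ?_
    rw [div_le_div_iff₀ (by positivity) hk, mul_assoc (Real.exp 1 * √n), ← mul_pow,
      ← Real.sqrt_mul (by positivity)]
    gcongr
    have hlt : k % n < n := Nat.mod_lt _ (by omega)
    have : k + 1 ≤ 2 * n * m := by nlinarith
    exact_mod_cast this

theorem exists_sum_sqNorm_single_le (hn : 4 ≤ n) :
    ∃ C : ℝ, ∀ (v : Fin n → ℤ) (t : ℕ),
      ∑ k ∈ Finset.range t, sqNorm (descend^[k] (Finsupp.single v 1)) ≤ C := by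
  have hsum : Summable fun k : ℕ =>
      Real.exp 1 * √n * √(2 * n) ^ 3 / √(k + 1 : ℕ) ^ 3 := by
    have h := (summable_nat_add_iff 1).2
      (Real.summable_one_div_nat_rpow.2 (by norm_num : (1 : ℝ) < 3 / 2))
    refine (h.mul_left (Real.exp 1 * √n * √(2 * n) ^ 3)).congr fun k => ?_
    have hpow : √((k + 1 : ℕ) : ℝ) ^ 3 = ((k + 1 : ℕ) : ℝ) ^ (3 / 2 : ℝ) := by
      rw [Real.sqrt_eq_rpow, ← Real.rpow_mul_natCast (by positivity)]
      norm_num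
    rw [mul_one_div, hpow]
  refine ⟨_, fun v t => (Finset.sum_le_sum fun k _ =>
    sqNorm_iterate_descend_single_le v (iterate_descend_single_le hn k v)).trans
      (hsum.sum_le_tsum _ fun k _ => by positivity)⟩

end Decay

/-! ## Lower bound in dimension at most two -/

section Spread

variable {n : ℕ}

/-- The operator on functions dual to `descend`. -/
noncomputable def latticeAverage (f : (Fin n → ℤ) → ℝ) (x : Fin n → ℤ) : ℝ :=
  (1 / n : ℝ) * ∑ i, f (x - Pi.single i 1)

theorem linearCombination_iterate_descend (f : (Fin n → ℤ) → ℝ) (c : (Fin n → ℤ) →₀ ℝ) (k : ℕ) :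
    Finsupp.linearCombination ℝ f (descend^[k] c) =
      Finsupp.linearCombination ℝ (latticeAverage^[k] f) c := by
  induction k generalizing f with
  | zero => rfl
  | succ k ih =>
    rw [Function.iterate_succ_apply', linearCombination_descend, Function.iterate_succ_apply, ← ih]
    rfl

theorem latticeAverage_mono : Monotone (latticeAverage (n := n)) := fun f g h x => by
  unfold latticeAverage
  gcongr with i
  exact h _

theorem iterate_latticeAverage_nonneg {f : (Fin n → ℤ) → ℝ} (hf : 0 ≤ f) (k : ℕ) :
    0 ≤ latticeAverage^[k] f := by
  induction k with
  | zero => exact hf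
  | succ k ih =>
    rw [Function.iterate_succ_apply']
    exact fun x => mul_nonneg (by positivity) (Finset.sum_nonneg fun i _ => ih _)

/-- Second moment of the random walk, centred at its mean. -/
theorem iterate_latticeAverage_sum_sq [NeZero n] (x : Fin n → ℤ) (s : ℝ) (k : ℕ) :
    latticeAverage^[k] (fun y => ∑ i, (n * ((y i : ℝ) - x i) + s + k) ^ 2) =
      fun y => ∑ i, (n * ((y i : ℝ) - x i) + s) ^ 2 + n * (k * (n - 1)) := by
  have hn : (n : ℝ) ≠ 0 := Nat.cast_ne_zero.2 (NeZero.ne n)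
  induction k generalizing s with
  | zero => simp
  | succ k ih =>
    have h := ih (s + 1)
    rw [Function.iterate_succ_apply']
    have hcongr : (fun y : Fin n → ℤ => ∑ i, (n * ((y i : ℝ) - x i) + s + (k + 1 : ℕ)) ^ 2) =
        fun y => ∑ i, (n * ((y i : ℝ) - x i) + (s + 1) + k) ^ 2 := by
      funext y
      refine Finset.sum_congr rfl fun i _ => ?_
      push_cast
      ring
    rw [hcongr, h]
    funext y
    -- After the shift by 1 that compensates the drift, one step adds `1` with probability `1 - 1/n`
    -- and `1 - n` with probability `1/n`: mean 0, variance `n - 1`, no cross term.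
    have key : ∀ i : Fin n, ∑ j : Fin n,
        (n * (((y - Pi.single j 1 : Fin n → ℤ) i : ℝ) - x i) + (s + 1)) ^ 2 =
          n * (n * ((y i : ℝ) - x i) + s) ^ 2 + n * (n - 1) := by
      intro i
      set z := n * ((y i : ℝ) - x i) + s with hz
      have : ∀ j : Fin n, (n * (((y - Pi.single j 1 : Fin n → ℤ) i : ℝ) - x i) + (s + 1)) ^ 2 =
          (z + 1) ^ 2 + if i = j then ((z + 1 - n) ^ 2 - (z + 1) ^ 2) else 0 := by
        intro j
        by_cases hij : i = j
        · subst hij; simp [hz]; ring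
        · simp [hz, hij]; ring
      simp_rw [this]
      rw [Finset.sum_add_distrib]
      simp
      ring
    unfold latticeAverage
    rw [Finset.sum_add_distrib, Finset.sum_comm]
    simp_rw [key]
    rw [Finset.sum_add_distrib, ← Finset.mul_sum]
    simp
    field_simp
    ring

theorem abs_linearCombination_le (c : (Fin n → ℤ) →₀ ℝ) {f : (Fin n → ℤ) → ℝ} {B : ℝ}
    (h0 : 0 ≤ f) (hf : ∀ x, c x ≠ 0 → f x ≤ B) :
    |Finsupp.linearCombination ℝ f c| ≤ (∑ x ∈ c.support, |c x|) * B := by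
  rw [Finsupp.linearCombination_apply, Finsupp.sum, Finset.sum_mul]
  refine (Finset.abs_sum_le_sum_abs _ _).trans (Finset.sum_le_sum fun x hx => ?_)
  rw [smul_eq_mul, abs_mul, abs_of_nonneg (h0 x)]
  exact mul_le_mul_of_nonneg_left (hf x (Finsupp.mem_support_iff.1 hx)) (abs_nonneg _)

/-- `c` is supported in the box of side `N` with corner `x`. -/
def InBox (c : (Fin n → ℤ) →₀ ℝ) (x : Fin n → ℤ) (N : ℕ) : Prop :=
  ∀ y, c y ≠ 0 → ∀ i, y i ∈ Set.Ico (x i) (x i + N)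

theorem InBox.card_support_le {c : (Fin n → ℤ) →₀ ℝ} {x : Fin n → ℤ} {N : ℕ} (h : InBox c x N) :
    c.support.card ≤ N ^ n := by
  have hsub : c.support ⊆ Fintype.piFinset fun i => Finset.Ico (x i) (x i + N) := by
    intro y hy
    simpa using h y (Finsupp.mem_support_iff.1 hy)
  simpa using Finset.card_le_card hsub

theorem InBox.sq_sum_abs_le {c : (Fin n → ℤ) →₀ ℝ} {x : Fin n → ℤ} {N : ℕ} (h : InBox c x N) :
    (∑ y ∈ c.support, |c y|) ^ 2 ≤ N ^ n * sqNorm c := by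
  refine (sq_sum_le_card_mul_sum_sq).trans ?_
  simp only [sq_abs]
  refine mul_le_mul_of_nonneg_right ?_ (sqNorm_nonneg c)
  exact_mod_cast h.card_support_le

theorem abs_mass_le (c : (Fin n → ℤ) →₀ ℝ) : |mass c| ≤ ∑ y ∈ c.support, |c y| := by
  rw [mass_eq_sum]
  exact Finset.abs_sum_le_sum_abs _ _

/-- The level determines coordinate `0` from the other `d`, each confined to an interval of length
at most `2 * D`. This is why the exponent is `d` and not `d + 1`. -/
theorem card_le_of_level_of_abs_le {d : ℕ} (S : Finset (Fin (d + 1) → ℤ)) (r : ℤ)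
    (x : Fin (d + 1) → ℤ) (b D : ℝ) (hD : 0 ≤ D) (hS : ∀ y ∈ S, ∑ i, y i = r)
    (hb : ∀ y ∈ S, ∀ i, |((d + 1 : ℕ) : ℝ) * ((y i : ℝ) - x i) + b| ≤ D) :
    (S.card : ℝ) ≤ (2 * D + 1) ^ d := by
  set lo : Fin d → ℝ := fun j => x j.succ - b / (d + 1 : ℕ) - D / (d + 1 : ℕ)
  set hi : Fin d → ℝ := fun j => x j.succ - b / (d + 1 : ℕ) + D / (d + 1 : ℕ)
  have hcard : S.card ≤ (Fintype.piFinset fun j => Finset.Icc ⌈lo j⌉ ⌊hi j⌋).card := by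
    refine Finset.card_le_card_of_injOn (fun y j => y j.succ) (fun y hy => ?_) ?_
    · simp only [Fintype.coe_piFinset, Finset.coe_Icc, Set.mem_pi, Set.mem_univ, Set.mem_Icc,
        forall_const, Int.ceil_le, Int.le_floor, lo, hi]
      intro j
      have hd : (0 : ℝ) < ((d + 1 : ℕ) : ℝ) := by positivity
      obtain ⟨h1, h2⟩ := abs_le.1 (hb y hy j.succ)
      constructor
      · rw [sub_sub, ← add_div, sub_le_iff_le_add, ← sub_le_iff_le_add', le_div_iff₀ hd]
        nlinarith
      · rw [sub_add, ← sub_div, le_sub_iff_add_le, ← le_sub_iff_add_le', div_le_iff₀ hd]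
        nlinarith
    · intro y hy y' hy' h
      have hs := (hS y hy).trans (hS y' hy').symm
      rw [Fin.sum_univ_succ, Fin.sum_univ_succ] at hs
      have hj : ∀ j : Fin d, y j.succ = y' j.succ := fun j => congrFun h j
      simp only [hj, add_left_inj] at hs
      funext i
      exact Fin.cases hs hj i
  have hcard' : (S.card : ℝ) ≤ ∏ j, ((Finset.Icc ⌈lo j⌉ ⌊hi j⌋).card : ℝ) := by
    rw [Fintype.card_piFinset] at hcard
    exact_mod_cast hcard
  refine hcard'.trans ?_
  have : ∀ j, ((Finset.Icc ⌈lo j⌉ ⌊hi j⌋).card : ℝ) ≤ 2 * D + 1 := by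
    intro j
    rw [Int.card_Icc]
    have h1 : D / ((d + 1 : ℕ) : ℝ) ≤ D := div_le_self hD (by push_cast; linarith [(Nat.cast_nonneg d : (0:ℝ) ≤ d)])
    have h2 : hi j - lo j ≤ 2 * D := by simp only [hi, lo]; linarith
    have h3 := Int.floor_le (hi j)
    have h4 := Int.le_ceil (lo j)
    have h5 : (((⌊hi j⌋ + 1 - ⌈lo j⌉).toNat : ℤ) : ℝ) = max ((⌊hi j⌋ : ℝ) + 1 - ⌈lo j⌉) 0 := by
      rw [Int.toNat_eq_max]; push_cast; rfl
    rw [← Int.cast_natCast, h5]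
    exact max_le (by linarith) (by linarith)
  calc ∏ j, ((Finset.Icc ⌈lo j⌉ ⌊hi j⌋).card : ℝ) ≤ ∏ _j : Fin d, (2 * D + 1) :=
        Finset.prod_le_prod (fun _ _ => by positivity) fun j _ => this j
    _ = _ := by simp

/-- After `k` steps the walk started from a boxed configuration is spread over `O(k)` points. -/
theorem sq_mass_le_mul_sqNorm_iterate {d : ℕ} (hd : d ≤ 2) {c : (Fin (d + 1) → ℤ) →₀ ℝ} {t : ℤ}
    (hc : OnLevel c t) {x : Fin (d + 1) → ℤ} {N : ℕ} (hbox : InBox c x N) {R : ℝ} (hR : 0 < R)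
    (hcR : (∑ y ∈ c.support, |c y|) * (((d + 1 : ℕ) : ℝ) * ((d + 1 : ℕ) ^ 2 * N ^ 2 + (d + 1 : ℕ))) ≤
      R ^ 2 * (|mass c| / 2)) {k : ℕ} (hk : 1 ≤ k) :
    mass c ^ 2 / 4 ≤ (2 * R + 1) ^ 2 * k * sqNorm (descend^[k] c) := by
  classical
  set h := descend^[k] c with hh
  have hk1 : (1 : ℝ) ≤ k := by exact_mod_cast hk
  have hsk : 1 ≤ √(k : ℝ) := Real.one_le_sqrt.2 hk1
  -- `G` holds near the mean of the walk started at the corner `x`, in coordinates scaled by `d +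
  -- 1`. Off `G` the second moment exceeds `f`, as in Chebyshev's inequality.
  let G : (Fin (d + 1) → ℤ) → Prop := fun y => ∀ i, |((d + 1 : ℕ) : ℝ) * ((y i : ℝ) - x i) + k| ≤ R * √k
  let f : (Fin (d + 1) → ℤ) → ℝ := fun y => if G y then 0 else R ^ 2 * k
  have hf0 : 0 ≤ f := fun y => by
    change 0 ≤ f y
    simp only [f]; split_ifs <;> positivity
  have hfle : f ≤ fun y => ∑ i, (((d + 1 : ℕ) : ℝ) * ((y i : ℝ) - x i) + 0 + k) ^ 2 := by
    intro y
    simp only [f]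
    split_ifs with hG
    · exact Finset.sum_nonneg fun i _ => sq_nonneg _
    · simp only [G, not_forall, not_le] at hG
      obtain ⟨i, hi⟩ := hG
      refine le_trans ?_ (Finset.single_le_sum (f := fun i => (((d + 1 : ℕ) : ℝ) * ((y i : ℝ) - x i) + 0 + k) ^ 2)
        (fun i _ => sq_nonneg _) (Finset.mem_univ i))
      have := pow_le_pow_left₀ (by positivity) hi.le 2
      rw [mul_pow, Real.sq_sqrt (by positivity), sq_abs] at this
      simpa using this
  have hav : ∀ y, c y ≠ 0 → latticeAverage^[k] f y ≤ k * (((d + 1 : ℕ) : ℝ) * (((d + 1 : ℕ) : ℝ) ^ 2 * N ^ 2 + ((d + 1 : ℕ) : ℝ))) := by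
    intro y hy
    have h1 := (latticeAverage_mono.iterate k) hfle y
    rw [iterate_latticeAverage_sum_sq x 0 k] at h1
    refine h1.trans ?_
    have h2 : ∀ i, (((d + 1 : ℕ) : ℝ) * ((y i : ℝ) - x i) + 0) ^ 2 ≤ ((d + 1 : ℕ) : ℝ) ^ 2 * N ^ 2 := by
      intro i
      obtain ⟨h3, h4⟩ := hbox y hy i
      have h3' : (x i : ℝ) ≤ y i := by exact_mod_cast h3
      have h4' : (y i : ℝ) ≤ x i + N := by exact_mod_cast h4.le
      rw [add_zero, mul_pow]
      gcongr <;> linarith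
    have h5 := Finset.sum_le_sum fun i (_ : i ∈ Finset.univ) => h2 i
    simp only [Finset.sum_const, Finset.card_univ, Fintype.card_fin, nsmul_eq_mul] at h5
    have hnn : (0 : ℝ) ≤ ((d + 1 : ℕ) : ℝ) := by positivity
    have hA : (0 : ℝ) ≤ ((d + 1 : ℕ) : ℝ) * (((d + 1 : ℕ) : ℝ) ^ 2 * N ^ 2) := by positivity
    have hB : (0 : ℝ) ≤ ((d + 1 : ℕ) : ℝ) * k := by positivity
    nlinarith
  -- As `c` may change sign, the escaping part is bounded through its `ℓ¹` norm; `hcR` makes `R`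
  -- large enough for this to be at most half of the mass.
  have hout : |∑ y ∈ h.support.filter (fun y => ¬ G y), h y| ≤ |mass c| / 2 := by
    have h1 := abs_linearCombination_le c (iterate_latticeAverage_nonneg hf0 k) hav
    rw [← linearCombination_iterate_descend, ← hh] at h1
    have h2 : Finsupp.linearCombination ℝ f h =
        R ^ 2 * k * ∑ y ∈ h.support.filter (fun y => ¬ G y), h y := by
      rw [Finsupp.linearCombination_apply, Finsupp.sum, Finset.sum_filter, Finset.mul_sum]
      refine Finset.sum_congr rfl fun y _ => ?_
      by_cases hG : G y
      · simp [f, hG]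
      · simp [f, hG, mul_comm]
    rw [h2, abs_mul, abs_of_pos (by positivity)] at h1
    refine le_of_mul_le_mul_left (h1.trans ?_) (by positivity : (0 : ℝ) < R ^ 2 * k)
    calc _ = k * ((∑ y ∈ c.support, |c y|) * (((d + 1 : ℕ) : ℝ) * (((d + 1 : ℕ) : ℝ) ^ 2 * N ^ 2 + ((d + 1 : ℕ) : ℝ)))) := by ring
      _ ≤ k * (R ^ 2 * (|mass c| / 2)) := by gcongr
      _ = _ := by ring
  set S := h.support.filter G with hSdef
  have hin : |mass c| / 2 ≤ |∑ y ∈ S, h y| := by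
    have h1 : mass c = ∑ y ∈ S, h y + ∑ y ∈ h.support.filter (fun y => ¬ G y), h y := by
      rw [← mass_iterate_descend c k, mass_eq_sum, Finset.sum_filter_add_sum_filter_not]
    have h2 := abs_add_le (∑ y ∈ S, h y) (∑ y ∈ h.support.filter (fun y => ¬ G y), h y)
    rw [← h1] at h2
    linarith
  have hcs : (∑ y ∈ S, h y) ^ 2 ≤ S.card * sqNorm h := by
    refine (sq_sum_le_card_mul_sum_sq).trans ?_
    gcongr
    exact Finset.sum_le_sum_of_subset_of_nonneg (Finset.filter_subset _ _) fun _ _ _ => sq_nonneg _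
  have hcard : (S.card : ℝ) ≤ (2 * R + 1) ^ 2 * k := by
    have h1 := card_le_of_level_of_abs_le S (t - k) x k (R * √k) (by positivity)
      (fun y hy => hc.iterate_descend k y (Finsupp.mem_support_iff.1 (Finset.mem_filter.1 hy).1))
      (fun y hy => (Finset.mem_filter.1 hy).2)
    have h2 : 2 * (R * √k) + 1 ≤ (2 * R + 1) * √k := by linarith
    calc (S.card : ℝ) ≤ (2 * (R * √k) + 1) ^ d := h1
      _ ≤ (2 * (R * √k) + 1) ^ 2 := pow_le_pow_right₀ (by nlinarith) hd
      _ ≤ ((2 * R + 1) * √k) ^ 2 := by gcongr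
      _ = _ := by rw [mul_pow, Real.sq_sqrt (by positivity)]
  calc mass c ^ 2 / 4 = (|mass c| / 2) ^ 2 := by rw [div_pow, sq_abs]; norm_num
    _ ≤ |∑ y ∈ S, h y| ^ 2 := by gcongr
    _ = (∑ y ∈ S, h y) ^ 2 := sq_abs _
    _ ≤ S.card * sqNorm h := hcs
    _ ≤ _ := mul_le_mul_of_nonneg_right hcard (sqNorm_nonneg h)

/-- Cancellation in `c` is harmless: either the term `k = 0` already exceeds `K * mass c ^ 2`, or
the `ℓ¹` norm is at most `M * |mass c|`. In the second case `R` depends on `d`, `N`, `K` only, so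
the harmonic lower bound is uniform in `c` and in the window. -/
theorem exists_mul_sq_mass_le_sum_sqNorm {d : ℕ} (hd : d ≤ 2) (N : ℕ) (K : ℝ) :
    ∃ t₀ : ℕ, ∀ t ≥ t₀, ∀ (c : (Fin (d + 1) → ℤ) →₀ ℝ) (x : Fin (d + 1) → ℤ),
      OnLevel c t → InBox c x N →
        K * mass c ^ 2 ≤ ∑ k ∈ Finset.range t, sqNorm (descend^[k] c) := by
  set A : ℝ := ((d + 1 : ℕ) : ℝ) * ((d + 1 : ℕ) ^ 2 * N ^ 2 + (d + 1 : ℕ)) with hA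
  set M : ℝ := √(N ^ (d + 1) * K) with hM
  have hApos : 0 < A := by positivity
  -- Chosen so that `M * A ≤ R ^ 2 / 2`; the `+ 1` keeps `R` positive.
  set R : ℝ := √(2 * M * A + 1) with hRdef
  have hR2 : R ^ 2 = 2 * M * A + 1 := Real.sq_sqrt (by positivity)
  have hR : 0 < R := Real.sqrt_pos.2 (by positivity)
  have hD : 0 < 4 * (2 * R + 1) ^ 2 := by positivity
  obtain ⟨t₁, ht₁⟩ := eventually_atTop.1
    ((tendsto_atTop.1 Real.tendsto_sum_range_one_div_nat_succ_atTop) (4 * (2 * R + 1) ^ 2 * K))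
  refine ⟨t₁ + 1, fun t ht c x hc hbox => ?_⟩
  by_contra! hlt
  obtain ⟨t, rfl⟩ : ∃ t', t = t' + 1 := ⟨t - 1, by omega⟩
  rw [Finset.sum_range_succ'] at hlt
  simp only [Function.iterate_zero, id] at hlt
  have hnn : 0 ≤ ∑ k ∈ Finset.range t, sqNorm (descend^[k + 1] c) :=
    Finset.sum_nonneg fun _ _ => sqNorm_nonneg _
  have hl1 : ∑ y ∈ c.support, |c y| ≤ M * |mass c| := by
    refine Real.abs_le_sqrt (x := ∑ y ∈ c.support, |c y|)
      (y := N ^ (d + 1) * K * mass c ^ 2) ?_ |> (le_abs_self _).trans |>.trans ?_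
    · refine hbox.sq_sum_abs_le.trans ?_
      rw [mul_assoc]
      gcongr
      linarith
    · rw [Real.sqrt_mul' _ (sq_nonneg _), Real.sqrt_sq_eq_abs]
  have hcR : (∑ y ∈ c.support, |c y|) * A ≤ R ^ 2 * (|mass c| / 2) := by
    rw [hR2]
    nlinarith [mul_le_mul_of_nonneg_right hl1 hApos.le, abs_nonneg (mass c)]
  have hterm : ∀ k ∈ Finset.range t,
      mass c ^ 2 / (4 * (2 * R + 1) ^ 2) * (1 / ((k : ℝ) + 1)) ≤ sqNorm (descend^[k + 1] c) := by
    intro k _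
    have := sq_mass_le_mul_sqNorm_iterate hd hc hbox hR hcR (Nat.succ_le_succ (Nat.zero_le k))
    rw [div_mul_div_comm, div_le_iff₀ (by positivity)]
    push_cast at this
    linarith
  have hsum := Finset.sum_le_sum hterm
  rw [← Finset.mul_sum] at hsum
  have hK : K * mass c ^ 2 ≤ mass c ^ 2 / (4 * (2 * R + 1) ^ 2) *
      ∑ k ∈ Finset.range t, 1 / ((k : ℝ) + 1) := by
    refine le_trans (le_of_eq ?_)
      (mul_le_mul_of_nonneg_left (ht₁ t (by omega)) (by positivity))
    field_simp
  linarith [sqNorm_nonneg c]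

end Spread

/-! ## Covering pairs of the half-space -/

section HalfSpaceOrder

variable {n d : ℕ}

theorem HalfSpace.mk_sub_single_covBy {x : Fin n → ℤ} {i : Fin n}
    (h : 0 ≤ ∑ j, (x - Pi.single i 1 : Fin n → ℤ) j) (h' : 0 ≤ ∑ j, x j) :
    (⟨x - Pi.single i 1, h⟩ : HalfSpace n) ⋖ ⟨x, h'⟩ := by
  constructor
  · refine lt_of_le_of_ne (fun j => ?_) fun he => ?_
    · by_cases hj : j = i
      · subst hj; simp
      · simp [hj]
    · have := congrFun (congrArg Subtype.val he) i
      simp at this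
  · intro w hw hw'
    have h1 := HalfSpace.sum_lt hw
    have h2 := HalfSpace.sum_lt hw'
    have h3 := sum_sub_single x i
    simp only at h1 h2
    omega

theorem HalfSpace.exists_eq_sub_single {u v : HalfSpace n} (h : u ⋖ v) :
    ∃ i, u.1 = v.1 - Pi.single i 1 := by
  have hle : ∀ i, u.1 i ≤ v.1 i := h.lt.le
  obtain ⟨i, hi⟩ : ∃ i, u.1 i < v.1 i := by
    by_contra! hc
    exact h.lt.not_ge (show v ≤ u from hc)
  refine ⟨i, ?_⟩
  have hle' : ∀ j ∈ Finset.univ, u.1 j ≤ (v.1 - Pi.single i 1 : Fin n → ℤ) j := by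
    intro j _
    by_cases hj : j = i
    · subst hj; simp; omega
    · simpa [hj] using hle j
  have hsum : ∑ j, u.1 j = ∑ j, (v.1 - Pi.single i 1 : Fin n → ℤ) j := by
    rw [sum_sub_single, HalfSpace.sum_covBy h]; ring
  funext j
  exact (Finset.sum_eq_sum_iff_of_le hle').1 hsum j (Finset.mem_univ j)

theorem HalfSpace.isMin_of_sum_eq_zero {v : HalfSpace n} (h : ∑ i, v.1 i = 0) : IsMin v := by
  intro w hw
  by_contra hc
  have h1 := HalfSpace.sum_lt (lt_of_le_not_ge hw hc)
  have h2 := w.2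
  omega

theorem sum_sub_single_nonneg {x : Fin n → ℤ} (h : 1 ≤ ∑ j, x j) (i : Fin n) :
    0 ≤ ∑ j, (x - Pi.single i 1 : Fin n → ℤ) j := by
  rw [sum_sub_single]; omega

/-- The covering pair `v - eᵢ ⋖ v`. -/
def coverEdge (v : Fin n → ℤ) (h : 1 ≤ ∑ j, v j) (i : Fin n) : CoverPair (HalfSpace n) :=
  ⟨(⟨v - Pi.single i 1, sum_sub_single_nonneg h i⟩, ⟨v, by omega⟩),
    HalfSpace.mk_sub_single_covBy _ _⟩

theorem sub_single_injective (v : Fin n → ℤ) :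
    Function.Injective fun i => (v - Pi.single i 1 : Fin n → ℤ) := by
  intro i j h
  by_contra hij
  have := congrFun h i
  simp [hij] at this

/-- Each noise variable enters at exactly one lattice point, so the total noises at distinct points
are uncorrelated. -/
theorem coverEdge_eq_iff {v w : Fin n → ℤ} (hv : 1 ≤ ∑ j, v j) (hw : 1 ≤ ∑ j, w j) (i j : Fin n) :
    coverEdge v hv i = coverEdge w hw j ↔ v = w ∧ i = j := by
  constructor
  · intro h
    have h1 := congrArg (fun e : CoverPair (HalfSpace n) => e.1.2.1) h
    have h2 := congrArg (fun e : CoverPair (HalfSpace n) => e.1.1.1) h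
    simp only [coverEdge] at h1 h2
    subst h1
    exact ⟨rfl, sub_single_injective v h2⟩
  · rintro ⟨rfl, rfl⟩
    rfl

theorem coverEdge_bijective (v : HalfSpace n) (h : 1 ≤ ∑ j, v.1 j) :
    Function.Bijective fun i : Fin n =>
      (⟨(coverEdge v.1 h i).1.1, (coverEdge v.1 h i).2⟩ : {u : HalfSpace n // u ⋖ v}) := by
  constructor
  · intro i j hij
    exact sub_single_injective v.1 (congrArg (fun u => u.1.1) hij)
  · rintro ⟨u, hu⟩
    obtain ⟨i, hi⟩ := HalfSpace.exists_eq_sub_single hu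
    exact ⟨i, Subtype.ext (Subtype.ext hi.symm)⟩

theorem modelField_eq_sum {Ω : Type*} (α : ℕ → ℝ) (ε : ℝ) (X₀ : Ω → ℝ)
    (W : CoverPair (HalfSpace (d + 1)) → Ω → ℝ) (v : HalfSpace (d + 1)) (h : 1 ≤ ∑ j, v.1 j)
    (ω : Ω) :
    modelField α ε X₀ W v ω = α (d + 1) * ∑ i,
      (modelField α ε X₀ W (coverEdge v.1 h i).1.1 ω + ε * W (coverEdge v.1 h i) ω) := by
  have hb := coverEdge_bijective v h
  have hmin : ¬ IsMin v := fun hm =>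
    (coverEdge v.1 h 0).2.lt.not_ge (hm (coverEdge v.1 h 0).2.le)
  have hcard : {u : HalfSpace (d + 1) | u ⋖ v}.ncard = d + 1 := by
    rw [← Nat.card_coe_set_eq]
    exact (Nat.card_congr (Equiv.ofBijective _ hb)).symm.trans (Nat.card_fin _)
  rw [modelField_of_not_isMin _ _ _ _ hmin, hcard, ← finsum_eq_sum_of_fintype]
  congr 1
  exact (finsum_eq_of_bijective _ hb fun i => rfl).symm

end HalfSpaceOrder

/-! ## The field on the lattice -/

section LatticeField

variable {d : ℕ} {Ω : Type*}

/-- The extension by zero of a field from the half-space to the lattice. -/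
noncomputable def latticeField {n : ℕ} (X : HalfSpace n → Ω → ℝ) (x : Fin n → ℤ) : Ω → ℝ :=
  if h : 0 ≤ ∑ i, x i then X ⟨x, h⟩ else 0

/-- The total noise entering at a lattice point. -/
noncomputable def totalNoise {n : ℕ} (W : CoverPair (HalfSpace n) → Ω → ℝ) (x : Fin n → ℤ) :
    Ω → ℝ :=
  if h : 1 ≤ ∑ i, x i then ∑ i, W (coverEdge x h i) else 0

theorem latticeField_of_sum_eq_zero (α : ℕ → ℝ) (ε : ℝ) (X₀ : Ω → ℝ)
    (W : CoverPair (HalfSpace (d + 1)) → Ω → ℝ) {x : Fin (d + 1) → ℤ} (h : ∑ i, x i = 0) :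
    latticeField (modelField α ε X₀ W) x = X₀ := by
  rw [latticeField, dif_pos h.ge]
  exact modelField_of_isMin _ _ _ _ (HalfSpace.isMin_of_sum_eq_zero h)

theorem latticeField_of_one_le_sum (α : ℕ → ℝ) (ε : ℝ) (X₀ : Ω → ℝ)
    (W : CoverPair (HalfSpace (d + 1)) → Ω → ℝ) {x : Fin (d + 1) → ℤ} (h : 1 ≤ ∑ i, x i) :
    latticeField (modelField α ε X₀ W) x =
      (α (d + 1) * (d + 1 : ℕ)) • ((1 / (d + 1 : ℕ) : ℝ) •
        ∑ i, latticeField (modelField α ε X₀ W) (x - Pi.single i 1)) +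
      (α (d + 1) * ε) • totalNoise W x := by
  have hd : ((d + 1 : ℕ) : ℝ) ≠ 0 := by positivity
  have hx : ∀ i, latticeField (modelField α ε X₀ W) (x - Pi.single i 1) =
      modelField α ε X₀ W (coverEdge x h i).1.1 := fun i =>
    dif_pos (sum_sub_single_nonneg h i)
  funext ω
  rw [latticeField, dif_pos (by omega), modelField_eq_sum α ε X₀ W ⟨x, by omega⟩ h, totalNoise,
    dif_pos h]
  simp only [hx, Pi.add_apply, Pi.smul_apply, Finset.sum_apply, smul_eq_mul,
    Finset.sum_add_distrib, ← Finset.mul_sum]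
  field_simp

theorem linearCombination_latticeField_succ (α : ℕ → ℝ) (ε : ℝ) (X₀ : Ω → ℝ)
    (W : CoverPair (HalfSpace (d + 1)) → Ω → ℝ) {c : (Fin (d + 1) → ℤ) →₀ ℝ} {t : ℤ} (ht : 1 ≤ t)
    (hc : OnLevel c t) :
    Finsupp.linearCombination ℝ (latticeField (modelField α ε X₀ W)) c =
      (α (d + 1) * (d + 1 : ℕ)) •
        Finsupp.linearCombination ℝ (latticeField (modelField α ε X₀ W)) (descend c) +
      (α (d + 1) * ε) • Finsupp.linearCombination ℝ (totalNoise W) c := by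
  rw [linearCombination_descend]
  simp only [Finsupp.linearCombination_apply, Finsupp.sum]
  rw [Finset.smul_sum, Finset.smul_sum, ← Finset.sum_add_distrib]
  refine Finset.sum_congr rfl fun x hx => ?_
  rw [latticeField_of_one_le_sum α ε X₀ W (by rw [hc x (Finsupp.mem_support_iff.1 hx)]; exact ht),
    smul_add, smul_comm (c x), smul_comm (c x) (α (d + 1) * ε)]

/-- Each descent by one layer releases a factor `ρ` and the noise of that layer. At layer 0 every
value is `X₀`, so only the total mass matters, and `descend` preserves it. -/
theorem linearCombination_latticeField (α : ℕ → ℝ) (ε : ℝ) (X₀ : Ω → ℝ)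
    (W : CoverPair (HalfSpace (d + 1)) → Ω → ℝ) {c : (Fin (d + 1) → ℤ) →₀ ℝ} {t : ℕ}
    (hc : OnLevel c t) :
    Finsupp.linearCombination ℝ (latticeField (modelField α ε X₀ W)) c =
      ((α (d + 1) * (d + 1 : ℕ)) ^ t * mass c) • X₀ +
      (α (d + 1) * ε) • ∑ k ∈ Finset.range t, (α (d + 1) * (d + 1 : ℕ)) ^ k •
        Finsupp.linearCombination ℝ (totalNoise W) (descend^[k] c) := by
  induction t generalizing c with
  | zero =>
    simp only [pow_zero, one_mul, Finset.range_zero, Finset.sum_empty, smul_zero, add_zero]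
    rw [mass_eq_sum, Finset.sum_smul, Finsupp.linearCombination_apply, Finsupp.sum]
    refine Finset.sum_congr rfl fun x hx => ?_
    rw [latticeField_of_sum_eq_zero _ _ _ _ (by simpa using hc x (Finsupp.mem_support_iff.1 hx))]
  | succ t ih =>
    have hc' : OnLevel (descend c) t := by simpa using hc.descend
    rw [linearCombination_latticeField_succ α ε X₀ W (by push_cast; omega) hc, ih hc',
      mass_descend, Finset.sum_range_succ', smul_add, smul_add, smul_smul, ← mul_assoc, ← pow_succ',
      smul_comm _ (α (d + 1) * ε), Finset.smul_sum (r := α (d + 1) * ((d + 1 : ℕ) : ℝ))]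
    simp only [smul_smul, ← pow_succ', Function.iterate_succ_apply, Function.iterate_zero, id,
      pow_zero, one_smul]
    rw [add_assoc]

end LatticeField

/-! ## Variances and covariances -/

section Moments

variable {d : ℕ} {Ω : Type*} [MeasurableSpace Ω] {μ : Measure Ω} {m : ℝ} {s : ℝ≥0} {X₀ : Ω → ℝ}

theorem memLp_two_of_hasLaw_gaussianReal {Y : Ω → ℝ} {a : ℝ} {v : ℝ≥0}
    (h : HasLaw Y (gaussianReal a v) μ) : MemLp Y 2 μ := by
  have := memLp_id_gaussianReal (μ := a) (v := v) 2
  rw [← h.map_eq, memLp_map_measure_iff (by fun_prop) h.aemeasurable] at this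
  exact this

theorem variance_of_hasLaw_gaussianReal {Y : Ω → ℝ} {a : ℝ} {v : ℝ≥0}
    (h : HasLaw Y (gaussianReal a v) μ) : Var[Y; μ] = v := by
  rw [h.variance_eq, variance_id_gaussianReal]

namespace IsGaussianInput

section General

variable {P : Type*} [PartialOrder P] {W : CoverPair P → Ω → ℝ}

theorem memLp_root (hin : IsGaussianInput μ m s X₀ W) : MemLp X₀ 2 μ :=
  memLp_two_of_hasLaw_gaussianReal hin.law_root

theorem memLp_noise (hin : IsGaussianInput μ m s X₀ W) (e : CoverPair P) : MemLp (W e) 2 μ :=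
  memLp_two_of_hasLaw_gaussianReal (hin.law_noise e)

theorem variance_root (hin : IsGaussianInput μ m s X₀ W) : Var[X₀; μ] = s :=
  variance_of_hasLaw_gaussianReal hin.law_root

open Classical in
theorem cov_noise (hin : IsGaussianInput μ m s X₀ W) (e e' : CoverPair P) :
    cov[W e, W e'; μ] = if e = e' then 1 else 0 := by
  split_ifs with h
  · subst h
    rw [covariance_self (hin.memLp_noise e).aemeasurable,
      variance_of_hasLaw_gaussianReal (hin.law_noise e)]
    simp
  · have := hin.indep.indepFun (i := some e) (j := some e') (by simpa using h)
    exact this.covariance_eq_zero (hin.memLp_noise e) (hin.memLp_noise e')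

theorem cov_root_noise (hin : IsGaussianInput μ m s X₀ W) (e : CoverPair P) :
    cov[X₀, W e; μ] = 0 := by
  have := hin.indep.indepFun (i := none) (j := some e) (by simp)
  exact this.covariance_eq_zero hin.memLp_root (hin.memLp_noise e)

end General

variable {n : ℕ} {W : CoverPair (HalfSpace n) → Ω → ℝ}

theorem memLp_totalNoise (hin : IsGaussianInput μ m s X₀ W) (x : Fin n → ℤ) :
    MemLp (totalNoise W x) 2 μ := by
  unfold totalNoise
  split_ifs
  · exact memLp_finsetSum' _ fun i _ => hin.memLp_noise _
  · exact MemLp.zero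

theorem memLp_linearCombination (hin : IsGaussianInput μ m s X₀ W) (p : (Fin n → ℤ) →₀ ℝ) :
    MemLp (Finsupp.linearCombination ℝ (totalNoise W) p) 2 μ := by
  rw [Finsupp.linearCombination_apply, Finsupp.sum]
  exact memLp_finsetSum' _ fun x _ => (hin.memLp_totalNoise x).const_smul _

variable [IsProbabilityMeasure μ]

theorem cov_totalNoise (hin : IsGaussianInput μ m s X₀ W) {x y : Fin n → ℤ}
    (hx : 1 ≤ ∑ i, x i) (hy : 1 ≤ ∑ i, y i) :
    cov[totalNoise W x, totalNoise W y; μ] = if x = y then (n : ℝ) else 0 := by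
  classical
  rw [totalNoise, dif_pos hx, totalNoise, dif_pos hy,
    covariance_sum_sum (fun i => hin.memLp_noise _) fun i => hin.memLp_noise _]
  simp only [hin.cov_noise, coverEdge_eq_iff]
  split_ifs with h <;> simp [h]

theorem cov_root_totalNoise (hin : IsGaussianInput μ m s X₀ W) (x : Fin n → ℤ) :
    cov[X₀, totalNoise W x; μ] = 0 := by
  unfold totalNoise
  split_ifs
  · rw [covariance_sum_right (fun i => hin.memLp_noise _) hin.memLp_root]
    simp [hin.cov_root_noise]
  · simp

theorem cov_root_linearCombination (hin : IsGaussianInput μ m s X₀ W) (p : (Fin n → ℤ) →₀ ℝ) :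
    cov[X₀, Finsupp.linearCombination ℝ (totalNoise W) p; μ] = 0 := by
  rw [Finsupp.linearCombination_apply, Finsupp.sum, covariance_sum_right'
    (fun x _ => (hin.memLp_totalNoise x).const_smul _) hin.memLp_root]
  simp [covariance_smul_right, hin.cov_root_totalNoise]

/-- Total noises at points of positive level are orthogonal, each of variance `n`. The bounds on `r`
and `r'` avoid the levels where `totalNoise` is 0 by default. -/
theorem cov_linearCombination (hin : IsGaussianInput μ m s X₀ W) {p q : (Fin n → ℤ) →₀ ℝ}
    {r r' : ℤ} (hr : 1 ≤ r) (hr' : 1 ≤ r') (hp : OnLevel p r) (hq : OnLevel q r') :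
    cov[Finsupp.linearCombination ℝ (totalNoise W) p,
      Finsupp.linearCombination ℝ (totalNoise W) q; μ] = n * ∑ x ∈ p.support, p x * q x := by
  rw [Finsupp.linearCombination_apply, Finsupp.sum, Finsupp.linearCombination_apply, Finsupp.sum,
    covariance_sum_sum' (fun x _ => (hin.memLp_totalNoise x).const_smul _)
      fun x _ => (hin.memLp_totalNoise x).const_smul _, Finset.mul_sum]
  refine Finset.sum_congr rfl fun x hx => ?_
  have hx1 : 1 ≤ ∑ i, x i := by rw [hp x (Finsupp.mem_support_iff.1 hx)]; exact hr
  have : ∀ y ∈ q.support, cov[p x • totalNoise W x, q y • totalNoise W y; μ] =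
      if x = y then n * (p x * q y) else 0 := by
    intro y hy
    rw [covariance_smul_left, covariance_smul_right, hin.cov_totalNoise hx1
      (by rw [hq y (Finsupp.mem_support_iff.1 hy)]; exact hr')]
    split_ifs <;> ring
  rw [Finset.sum_congr rfl this, Finset.sum_ite_eq]
  split_ifs with h
  · rfl
  · rw [Finsupp.notMem_support_iff.1 h]; ring

theorem cov_linearCombination_of_ne (hin : IsGaussianInput μ m s X₀ W) {p q : (Fin n → ℤ) →₀ ℝ}
    {r r' : ℤ} (hr : 1 ≤ r) (hr' : 1 ≤ r') (hp : OnLevel p r) (hq : OnLevel q r') (hne : r ≠ r') :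
    cov[Finsupp.linearCombination ℝ (totalNoise W) p,
      Finsupp.linearCombination ℝ (totalNoise W) q; μ] = 0 := by
  rw [hin.cov_linearCombination hr hr' hp hq, Finset.sum_eq_zero, mul_zero]
  intro x hx
  by_contra h
  exact hne ((hp x (left_ne_zero_of_mul h)).symm.trans (hq x (right_ne_zero_of_mul h)))

/-- The coefficients `descend^[k] c` live on level `t - k`, so distinct `k` involve disjoint sets of
noise variables and the variances add. -/
theorem variance_sum_smul_linearCombination (hin : IsGaussianInput μ m s X₀ W)
    {c : (Fin n → ℤ) →₀ ℝ} {t : ℕ} (hc : OnLevel c t) (ρ : ℝ) :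
    Var[∑ k ∈ Finset.range t, ρ ^ k •
        Finsupp.linearCombination ℝ (totalNoise W) (descend^[k] c); μ] =
      n * ∑ k ∈ Finset.range t, ρ ^ (2 * k) * sqNorm (descend^[k] c) := by
  rw [variance_sum' fun k _ => (hin.memLp_linearCombination _).const_smul _, Finset.mul_sum]
  refine Finset.sum_congr rfl fun k hk => ?_
  have hlev : ∀ k ∈ Finset.range t, (1 : ℤ) ≤ t - k := fun k hk => by
    have := Finset.mem_range.1 hk
    omega
  rw [Finset.sum_eq_single_of_mem k hk]
  · rw [covariance_smul_left, covariance_smul_right, hin.cov_linearCombination (hlev k hk)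
      (hlev k hk) (hc.iterate_descend k) (hc.iterate_descend k), sqNorm]
    simp only [← sq]
    ring
  · intro j hj hjk
    rw [covariance_smul_left, covariance_smul_right, hin.cov_linearCombination_of_ne (hlev k hk)
      (hlev j hj) (hc.iterate_descend k) (hc.iterate_descend j) (by omega)]
    ring

end IsGaussianInput

variable [IsProbabilityMeasure μ] {W : CoverPair (HalfSpace (d + 1)) → Ω → ℝ}

theorem cov_latticeField_root (hin : IsGaussianInput μ m s X₀ W) (α : ℕ → ℝ) (ε : ℝ)
    {c : (Fin (d + 1) → ℤ) →₀ ℝ} {t : ℕ} (hc : OnLevel c t) :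
    cov[Finsupp.linearCombination ℝ (latticeField (modelField α ε X₀ W)) c, X₀; μ] =
      (α (d + 1) * (d + 1 : ℕ)) ^ t * mass c * s := by
  have hk : ∀ k ∈ Finset.range t, MemLp ((α (d + 1) * ((d + 1 : ℕ) : ℝ)) ^ k •
      Finsupp.linearCombination ℝ (totalNoise W) (descend^[k] c)) 2 μ := fun k _ =>
    (hin.memLp_linearCombination _).const_smul _
  rw [linearCombination_latticeField α ε X₀ W hc, covariance_add_left
    (hin.memLp_root.const_smul _) ((memLp_finsetSum' _ hk).const_smul _) hin.memLp_root,
    covariance_smul_left, covariance_smul_left, covariance_sum_left' hk hin.memLp_root,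
    covariance_self hin.memLp_root.aemeasurable, hin.variance_root, Finset.sum_eq_zero, mul_zero,
    add_zero]
  intro k _
  rw [covariance_smul_left, covariance_comm, hin.cov_root_linearCombination, mul_zero]

theorem variance_latticeField (hin : IsGaussianInput μ m s X₀ W) (α : ℕ → ℝ) (ε : ℝ)
    {c : (Fin (d + 1) → ℤ) →₀ ℝ} {t : ℕ} (hc : OnLevel c t) :
    Var[Finsupp.linearCombination ℝ (latticeField (modelField α ε X₀ W)) c; μ] =
      ((α (d + 1) * (d + 1 : ℕ)) ^ t * mass c) ^ 2 * s +
      (α (d + 1) * ε) ^ 2 * ((d + 1 : ℕ) * ∑ k ∈ Finset.range t,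
        (α (d + 1) * (d + 1 : ℕ)) ^ (2 * k) * sqNorm (descend^[k] c)) := by
  have hk : ∀ k ∈ Finset.range t, MemLp ((α (d + 1) * ((d + 1 : ℕ) : ℝ)) ^ k •
      Finsupp.linearCombination ℝ (totalNoise W) (descend^[k] c)) 2 μ := fun k _ =>
    (hin.memLp_linearCombination _).const_smul _
  rw [linearCombination_latticeField α ε X₀ W hc, variance_add
    (hin.memLp_root.const_smul _) ((memLp_finsetSum' _ hk).const_smul _),
    covariance_smul_left, covariance_smul_right, covariance_sum_right' hk hin.memLp_root,
    variance_smul, variance_smul, hin.variance_root,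
    hin.variance_sum_smul_linearCombination hc]
  simp [covariance_smul_right, hin.cov_root_linearCombination]

end Moments

/-! ## Estimators as finite linear combinations on the lattice -/

section Estimator

variable {d : ℕ} {Ω : Type*}

theorem mem_layer_iff {t : ℕ} {u : HalfSpace (d + 1)} :
    u ∈ layer (HalfSpace (d + 1)) t ↔ ∑ i, u.1 i = t := by
  change (∑ i, u.1 i).toNat = t ↔ _
  have := u.2
  omega

theorem estimator_eq_linearCombination (X : HalfSpace (d + 1) → Ω → ℝ)
    {c : HalfSpace (d + 1) → ℝ} {t : ℕ} {p : (Fin (d + 1) → ℤ) →₀ ℝ} (hp : OnLevel p t)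
    (hpc : ∀ u ∈ layer (HalfSpace (d + 1)) t, p u.1 = c u) :
    estimator X c t = Finsupp.linearCombination ℝ (latticeField X) p := by
  classical
  funext ω
  rw [Finsupp.linearCombination_apply, Finsupp.sum, Finset.sum_apply, estimator]
  let T : Finset (HalfSpace (d + 1)) := p.support.subtype fun x => 0 ≤ ∑ i, x i
  have hT : ∀ u, u ∈ T →
      u ∈ layer (HalfSpace (d + 1)) t := fun u hu =>
    mem_layer_iff.2 (hp _ (Finsupp.mem_support_iff.1 (Finset.mem_subtype.1 hu)))
  rw [finsum_mem_eq_sum_of_inter_support_eq (t := T)]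
  · have hfilter : p.support.filter (fun x => 0 ≤ ∑ i, x i) = p.support :=
      Finset.filter_true_of_mem fun x hx => by
        rw [hp x (Finsupp.mem_support_iff.1 hx)]; positivity
    conv_rhs => rw [← hfilter]
    rw [← Finset.sum_subtype_eq_sum_filter]
    refine Finset.sum_congr rfl fun u hu => ?_
    rw [Pi.smul_apply, smul_eq_mul, latticeField, dif_pos u.2, hpc u (hT u hu)]
  · ext u
    simp only [Set.mem_inter_iff, Function.mem_support, SetLike.mem_coe]
    refine ⟨fun ⟨h1, h2⟩ => ⟨?_, h2⟩, fun ⟨h1, h2⟩ => ⟨hT u h1, h2⟩⟩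
    rw [Finset.mem_subtype, Finsupp.mem_support_iff, hpc u h1]
    exact left_ne_zero_of_mul h2

theorem exists_finsupp_of_window {c : HalfSpace (d + 1) → ℝ} {t : ℕ} {x : Fin (d + 1) → ℤ} {N : ℕ}
    (hc : ∀ u ∈ layer (HalfSpace (d + 1)) t, c u ≠ 0 → u ∈ window x N) :
    ∃ p : (Fin (d + 1) → ℤ) →₀ ℝ, OnLevel p t ∧ InBox p x N ∧
      ∀ u ∈ layer (HalfSpace (d + 1)) t, p u.1 = c u := by
  classical
  let f : (Fin (d + 1) → ℤ) → ℝ := fun y =>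
    if h : ∑ i, y i = t then c ⟨y, by rw [h]; positivity⟩ else 0
  have hf : ∀ y, f y ≠ 0 → ∑ i, y i = t ∧ ∀ i, y i ∈ Set.Ico (x i) (x i + N) := by
    intro y hy
    by_cases h : ∑ i, y i = t
    · simp only [f, dif_pos h] at hy
      exact ⟨h, hc _ (mem_layer_iff.2 h) hy⟩
    · simp [f, h] at hy
  refine ⟨Finsupp.onFinset (Fintype.piFinset fun i => Finset.Ico (x i) (x i + N)) f
    fun y hy => ?_, fun y hy => (hf y hy).1, fun y hy => (hf y hy).2, fun u hu => ?_⟩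
  · simpa using (hf y hy).2
  · exact dif_pos (mem_layer_iff.1 hu)

end Estimator

/-! ## Reconstruction criteria -/

section Criteria

/-- Here `A` stands for the signal `ρ ^ t * mass c` and `B` for the noise variance; the correlation
depends on the size of `B / A ^ 2` alone. -/
theorem le_div_sqrt_of_le {A B C s : ℝ} (hA : 0 < A) (hB : 0 ≤ B) (hs : 0 < s)
    (h : B ≤ C * A ^ 2) : s / √((s + C) * s) ≤ A * s / √((A ^ 2 * s + B) * s) := by
  have h1 : √((A ^ 2 * s + B) * s) ≤ A * √((s + C) * s) := by
    rw [← Real.sqrt_sq hA.le, ← Real.sqrt_mul (sq_nonneg A), Real.sqrt_sq hA.le]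
    refine Real.sqrt_le_sqrt ?_
    nlinarith
  calc s / √((s + C) * s) = A * s / (A * √((s + C) * s)) := by rw [mul_div_mul_left _ _ hA.ne']
    _ ≤ _ := by gcongr

/-- Squared, because the signal `A` may be negative or zero. -/
theorem sq_div_sqrt_le {A B K s : ℝ} (hK : 0 < K) (hs : 0 < s) (hpos : 0 < A ^ 2 * s + B)
    (h : K * A ^ 2 ≤ B) : (A * s / √((A ^ 2 * s + B) * s)) ^ 2 ≤ s / K := by
  rw [div_pow, Real.sq_sqrt (by positivity), div_le_div_iff₀ (by positivity) hK]
  have : 0 ≤ A ^ 2 * s * (s * s) := by positivity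
  nlinarith [mul_le_mul_of_nonneg_left h (by positivity : 0 ≤ s * s)]

variable {d : ℕ} {Ω : Type*} [MeasurableSpace Ω] {μ : Measure Ω} [IsProbabilityMeasure μ]
  {m : ℝ} {s : ℝ≥0} {X₀ : Ω → ℝ} {W : CoverPair (HalfSpace (d + 1)) → Ω → ℝ}

/-- The variance contributed by the noise to the estimator with coefficients `c` in layer `t`. -/
noncomputable def noiseVariance (a ε : ℝ) (t : ℕ) (c : (Fin (d + 1) → ℤ) →₀ ℝ) : ℝ :=
  (a * ε) ^ 2 * ((d + 1 : ℕ) * ∑ k ∈ Finset.range t,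
    (a * (d + 1 : ℕ)) ^ (2 * k) * sqNorm (descend^[k] c))

theorem noiseVariance_nonneg (a ε : ℝ) (t : ℕ) (c : (Fin (d + 1) → ℤ) →₀ ℝ) :
    0 ≤ noiseVariance a ε t c := by
  refine mul_nonneg (sq_nonneg _) (mul_nonneg (by positivity) (Finset.sum_nonneg fun k _ => ?_))
  rw [pow_mul]
  exact mul_nonneg (by positivity) (sqNorm_nonneg _)

theorem singleVertexReconstruction_of_noiseVariance_le (hin : IsGaussianInput μ m s X₀ W)
    (hs : 0 < s) (α : ℕ → ℝ) (hα : 0 < α (d + 1)) (ε C : ℝ)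
    (h : ∀ (t : ℕ) (v : Fin (d + 1) → ℤ), noiseVariance (α (d + 1)) ε t (Finsupp.single v 1) ≤
      C * ((α (d + 1) * (d + 1 : ℕ)) ^ t) ^ 2) :
    SingleVertexReconstruction μ X₀ (modelField α ε X₀ W) := by
  classical
  have hs' : (0 : ℝ) < s := hs
  have hC : 0 ≤ C := by
    have h1 := (noiseVariance_nonneg (α (d + 1)) ε 0 _).trans (h 0 0)
    simpa using h1
  have hρ : 0 < α (d + 1) * (d + 1 : ℕ) := by positivity
  -- The observed vertices run along the first axis; the hypothesis is uniform in `v`, so any choice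
  -- of one vertex per layer would serve.
  let v : ℕ → Fin (d + 1) → ℤ := fun t => Pi.single 0 (t : ℤ)
  let c : HalfSpace (d + 1) → ℝ := fun u => if u.1 = Pi.single 0 (u.1 0) then 1 else 0
  have hv : ∀ t, ∑ i, v t i = t := fun t => by simp [v]
  have hlayer : ∀ t, ∀ u ∈ layer (HalfSpace (d + 1)) t, (u.1 = Pi.single 0 (u.1 0) ↔ u.1 = v t) := by
    intro t u hu
    rw [mem_layer_iff] at hu
    constructor
    · intro he
      rw [he] at hu
      simp only [Finset.sum_pi_single', Finset.mem_univ, if_true] at hu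
      rw [he, hu]
    · intro he
      rw [he]
      simp [v]
  have hlev : ∀ t, OnLevel (Finsupp.single (v t) (1 : ℝ)) (t : ℤ) := by
    intro t y hy
    rw [Finsupp.single_apply] at hy
    have hy' : v t = y := by by_contra hne; simp [hne] at hy
    rw [← hy', hv]
  have hest : ∀ t, estimator (modelField α ε X₀ W) c t =
      Finsupp.linearCombination ℝ (latticeField (modelField α ε X₀ W)) (Finsupp.single (v t) 1) := by
    intro t
    refine estimator_eq_linearCombination _ (hlev t) fun u hu => ?_
    simp only [c, hlayer t u hu, Finsupp.single_apply, eq_comm]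
  have hvar : ∀ t, Var[estimator (modelField α ε X₀ W) c t; μ] =
      ((α (d + 1) * (d + 1 : ℕ)) ^ t) ^ 2 * s +
        noiseVariance (α (d + 1)) ε t (Finsupp.single (v t) 1) := by
    intro t
    rw [hest, variance_latticeField hin α ε (hlev t), mass_single, mul_one, noiseVariance]
  refine ⟨v, c, fun t u hu hcu i => ?_, fun t => ?_, fun hlim => ?_⟩
  · have : u.1 = v t := by
      by_contra hne
      simp [c, hlayer t u hu, hne] at hcu
    simp [this]
  · rw [hvar]
    have := noiseVariance_nonneg (α (d + 1)) ε t (Finsupp.single (v t) 1)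
    positivity
  · have hle : s / √((s + C) * s) ≤ 0 := by
      refine ge_of_tendsto' hlim fun t => ?_
      rw [correlation, hvar, hest, cov_latticeField_root hin α ε (hlev t), mass_single, mul_one,
        hin.variance_root]
      exact le_div_sqrt_of_le (by positivity) (noiseVariance_nonneg _ _ _ _) hs' (h t (v t))
    have : 0 < s / √((s + C) * s) := by positivity
    linarith

theorem not_localReconstruction_of_le_noiseVariance (hin : IsGaussianInput μ m s X₀ W)
    (hs : 0 < s) (α : ℕ → ℝ) (ε : ℝ)
    (h : ∀ (N : ℕ) (K : ℝ), 0 < K → ∃ t₀ : ℕ, ∀ t ≥ t₀,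
      ∀ (c : (Fin (d + 1) → ℤ) →₀ ℝ) (x : Fin (d + 1) → ℤ), OnLevel c t → InBox c x N →
        K * ((α (d + 1) * (d + 1 : ℕ)) ^ t * mass c) ^ 2 ≤ noiseVariance (α (d + 1)) ε t c) :
    ¬ LocalReconstruction μ X₀ (modelField α ε X₀ W) := by
  have hs' : (0 : ℝ) < s := hs
  rintro ⟨N, x, c, hwin, hpos, hlim⟩
  refine hlim (Metric.tendsto_atTop.2 fun δ hδ => ?_)
  -- This `K` makes the bound `s / K` on the squared correlation equal to `δ ^ 2 / 2`.
  obtain ⟨t₀, ht₀⟩ := h N (2 * s / δ ^ 2) (by positivity)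
  refine ⟨t₀, fun t ht => ?_⟩
  obtain ⟨p, hp, hbox, hpc⟩ := exists_finsupp_of_window (hwin t)
  have hest := estimator_eq_linearCombination (modelField α ε X₀ W) hp hpc
  have hvar := variance_latticeField hin α ε hp
  have hpos' := hpos t
  rw [hest, hvar, ← noiseVariance] at hpos'
  have hle := sq_div_sqrt_le (by positivity) hs' hpos' (ht₀ t ht p (x t) hp hbox)
  rw [Real.dist_0_eq_abs, correlation, hest, hvar, ← noiseVariance,
    cov_latticeField_root hin α ε hp, hin.variance_root]
  refine abs_lt_of_sq_lt_sq (hle.trans_lt ?_) hδ.le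
  rw [div_div_eq_mul_div, div_lt_iff₀ (by positivity)]
  nlinarith [mul_pos hs' (pow_pos hδ 2)]

end Criteria

/-! ### The supercritical, subcritical and critical regimes -/

theorem theorem2p4 (d : ℕ) (α : ℕ → ℝ) (hα : 0 < α (d + 1))
    (ε : ℝ) (hε : 0 < ε) (m : ℝ) (s : ℝ≥0) (hs : 0 < s)
    {Ω : Type*} [MeasurableSpace Ω] (μ : Measure Ω) [IsProbabilityMeasure μ]
    (X₀ : Ω → ℝ) (W : CoverPair (HalfSpace (d + 1)) → Ω → ℝ)
    (hin : IsGaussianInput μ m s X₀ W) :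
    (α (d + 1) > 1 / ((d : ℝ) + 1) →
      SingleVertexReconstruction μ X₀ (modelField α ε X₀ W)) ∧
    (α (d + 1) < 1 / ((d : ℝ) + 1) →
      ¬ LocalReconstruction μ X₀ (modelField α ε X₀ W)) ∧
    (α (d + 1) = 1 / ((d : ℝ) + 1) →
      (3 ≤ d → SingleVertexReconstruction μ X₀ (modelField α ε X₀ W)) ∧
      (d ≤ 2 → ¬ LocalReconstruction μ X₀ (modelField α ε X₀ W))) := by
  have hd : (0 : ℝ) < (d : ℝ) + 1 := by positivity
  have hdc : ((d + 1 : ℕ) : ℝ) = (d : ℝ) + 1 := by push_cast; rfl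
  have hD : 0 < (α (d + 1) * ε) ^ 2 * ((d + 1 : ℕ) : ℝ) := by positivity
  refine ⟨fun h => ?_, fun h => ?_, fun h => ⟨fun hd3 => ?_, fun hd2 => ?_⟩⟩
  · have hρ : 1 < α (d + 1) * (d + 1 : ℕ) := by rwa [hdc, ← div_lt_iff₀ hd]
    set ρ := α (d + 1) * ((d + 1 : ℕ) : ℝ) with hρdef
    have hρ2 : 1 < ρ ^ 2 := one_lt_pow₀ hρ two_ne_zero
    refine singleVertexReconstruction_of_noiseVariance_le hin hs α hα ε
      -- The factor `1 / (ρ ^ 2 - 1)` comes from the geometric sum, relative to `ρ ^ (2 * t)`.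
      ((α (d + 1) * ε) ^ 2 * ((d + 1 : ℕ) : ℝ) * (1 / (ρ ^ 2 - 1))) fun t v => ?_
    rw [noiseVariance, ← mul_assoc, mul_assoc _ (1 / _)]
    refine mul_le_mul_of_nonneg_left ?_ hD.le
    calc _ ≤ ∑ k ∈ Finset.range t, (ρ ^ 2) ^ k := by
          refine Finset.sum_le_sum fun k _ => ?_
          rw [← hρdef, pow_mul]
          exact mul_le_of_le_one_right (by positivity) (sqNorm_iterate_descend_single_le_one v k)
      _ = ((ρ ^ 2) ^ t - 1) / (ρ ^ 2 - 1) := geom_sum_eq hρ2.ne' t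
      _ ≤ 1 / (ρ ^ 2 - 1) * (ρ ^ t) ^ 2 := by
          rw [one_div_mul_eq_div, ← pow_mul, ← pow_mul, mul_comm t 2]
          have : 0 < ρ ^ 2 - 1 := by linarith
          gcongr
          linarith
  · have hρ : α (d + 1) * (d + 1 : ℕ) < 1 := by rwa [hdc, ← lt_div_iff₀ hd]
    have hρ0 : 0 < α (d + 1) * (d + 1 : ℕ) := by positivity
    refine not_localReconstruction_of_le_noiseVariance hin hs α ε fun N K hK => ?_
    set ρ := α (d + 1) * ((d + 1 : ℕ) : ℝ) with hρdef
    have hlim : Tendsto (fun t : ℕ => K * N ^ (d + 1) * (ρ ^ 2) ^ t) atTop (𝓝 0) := by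
      simpa using (tendsto_pow_atTop_nhds_zero_of_lt_one (sq_nonneg ρ)
        (pow_lt_one₀ hρ0.le hρ two_ne_zero)).const_mul (K * N ^ (d + 1))
    obtain ⟨t₀, ht₀⟩ := eventually_atTop.1 (hlim.eventually_le_const hD)
    -- The shift by 1 ensures `t ≥ 1`, so that the noise sum contains its term `k = 0`, the only one
    -- needed.
    refine ⟨t₀ + 1, fun t ht c x _ hbox => ?_⟩
    have h1 : mass c ^ 2 ≤ N ^ (d + 1) * sqNorm c := by
      rw [← sq_abs]
      exact (pow_le_pow_left₀ (abs_nonneg _) (abs_mass_le c) 2).trans hbox.sq_sum_abs_le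
    have h2 : sqNorm c ≤ ∑ k ∈ Finset.range t, ρ ^ (2 * k) * sqNorm (descend^[k] c) := by
      refine le_trans (by simp) (Finset.single_le_sum
        (f := fun k => ρ ^ (2 * k) * sqNorm (descend^[k] c))
        (fun k _ => mul_nonneg (by positivity) (sqNorm_nonneg _))
        (Finset.mem_range.2 (by omega : 0 < t)))
    calc K * (ρ ^ t * mass c) ^ 2 = K * (ρ ^ 2) ^ t * mass c ^ 2 := by ring
      _ ≤ K * (ρ ^ 2) ^ t * (N ^ (d + 1) * sqNorm c) := by gcongr
      _ = K * N ^ (d + 1) * (ρ ^ 2) ^ t * sqNorm c := by ring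
      _ ≤ (α (d + 1) * ε) ^ 2 * ((d + 1 : ℕ) : ℝ) * sqNorm c :=
        mul_le_mul_of_nonneg_right (ht₀ t (by omega)) (sqNorm_nonneg c)
      _ ≤ _ := by
        rw [noiseVariance, ← mul_assoc]
        exact mul_le_mul_of_nonneg_left h2 hD.le
  · have hρ : α (d + 1) * (d + 1 : ℕ) = 1 := by rw [hdc, h]; field_simp
    obtain ⟨C, hC⟩ := exists_sum_sqNorm_single_le (n := d + 1) (by omega)
    refine singleVertexReconstruction_of_noiseVariance_le hin hs α hα ε
      ((α (d + 1) * ε) ^ 2 * ((d + 1 : ℕ) : ℝ) * C) fun t v => ?_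
    simp only [noiseVariance, hρ, one_pow, one_mul, mul_one]
    rw [← mul_assoc]
    exact mul_le_mul_of_nonneg_left (hC v t) hD.le
  · have hρ : α (d + 1) * (d + 1 : ℕ) = 1 := by rw [hdc, h]; field_simp
    refine not_localReconstruction_of_le_noiseVariance hin hs α ε fun N K _ => ?_
    obtain ⟨t₀, ht₀⟩ := exists_mul_sq_mass_le_sum_sqNorm hd2 N
      (K / ((α (d + 1) * ε) ^ 2 * ((d + 1 : ℕ) : ℝ)))
    refine ⟨t₀, fun t ht c x hc hbox => ?_⟩
    have := ht₀ t ht c x hc hbox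
    rw [div_mul_eq_mul_div, div_le_iff₀ hD] at this
    simp only [noiseVariance, hρ, one_pow, one_mul]
    linarith
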